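/- Let $\phi:\mathbb{R}^N\to\mathbb{R}$ be a symmetric function of $x_1,\dots,x_N$. For $I\subseteq\{1,\dots,N\}$ non-empty, $1\le d\le N$, and points with pairwise distinct coordinates, put $$D_I\phi=\sum_{i\in I}\frac{\partial_i\phi}{\prod_{j\in I,\,j\ne i}(x_j-x_i)},\qquad D_d\phi=d!\sum_{|I|=d}D_I\phi .$$ At a point where some coordinates coincide, $D_d\phi$ denotes the limit of $D_d\phi$ along points with pairwise distinct coordinates tending to it. For a non-empty set of indices $J$, a point where all the $x_i$ with $i\in J$ are equal, and a partition $\sigma$ of $g$ into $l(\sigma)\le|J|$ parts, let $\partial_J^\sigma\phi$ be the derivative of order $g$ in which the parts of $\sigma$ are the orders of differentiation with respect to distinct variables $x_i$, $i\in J$ (by symmetry it does not depend on how the parts are assigned to indices). For $1\le g\le |J|$ let $$\partial_J^g\phi=\sum_{\sigma\vdash g}(-1)^{g-l(\sigma)}\frac{g\,(l(\sigma)-1)!}{\prod_{h=1}^g h!^{m_h}m_h!}\,\partial_J^\sigma\phi,$$ where $m_h$ is the multiplicity of $h$ in $\sigma$. **Proposition.** Let $\{1,\dots,N\}$ be the disjoint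 union of non-empty sets $H_1,\dots,H_M$, and take a point where $x_i=y_\alpha$ for every $i\in H_\alpha$, with $y_\alpha\neq y_\beta$ for $\alpha\ne\beta$. Let $1\le d\le N$, and assume that, for every $\alpha$, $\phi$ is of class $C^{\min(d,|H_\alpha|)}$ near this point. Then $D_d\phi$ exists at this point, and $$D_d\phi=d!\sum_{\alpha=1}^M\ \sum_{\sum_{\beta\neq\alpha}c_\beta<d}C_{\alpha,\vec c}\,\frac{\partial_{H_\alpha}^{\,d-\sum_{\beta\ne\alpha}c_\beta}\phi}{\prod_{\beta\neq\alpha}(y_\beta-y_\alpha)^{c_\beta}},$$ where the inner sum runs over tuples $\vec c=(c_\beta)_{\beta\ne\alpha}$ of integers $c_\beta\ge 0$, and $$C_{\alpha,\vec c}=\sum_{\vec\kappa\in\Xi_{\alpha,\vec c}}(-1)^{\sum_{\beta\ne\alpha}(c_\beta-\kappa_\beta)}\binom{|H_\alpha|}{d-\sum_{\beta\ne\alpha}\kappa_\beta}\prod_{\beta\ne\alpha,\ c_\beta>0}\binom{c_\beta-1}{\kappa_\beta-1}\binom{|H_\beta|}{\kappa_\beta},$$ with $\Xi_{\alpha,\vec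 c}$ the set of integer tuples $(\kappa_\beta)_{\beta\neq\alpha}$ such that $\kappa_\beta=0$ if $c_\beta=0$ and $1\le\kappa_\beta\le c_\beta$ if $c_\beta>0$. Terms in which the order $d-\sum_{\beta\ne\alpha} c_\beta$ exceeds $|H_\alpha|$ have $C_{\alpha,\vec c}=0$ and are understood to be $0$. -/

import Mathlib

open scoped Topology

noncomputable section

namespace SymmDeriv

/-- A function of `N` real variables is symmetric if it is invariant under all permutations of its
variables. -/
def IsSymmetric {N : ℕ} (φ : (Fin N → ℝ) → ℝ) : Prop :=
  ∀ (π : Equiv.Perm (Fin N)) (x : Fin N → ℝ), φ (x ∘ π) = φ x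

/-- The first order partial derivative `∂ᵢ φ` at `x`. -/
def partialDeriv {N : ℕ} (i : Fin N) (φ : (Fin N → ℝ) → ℝ) (x : Fin N → ℝ) : ℝ :=
  fderiv ℝ φ x (Pi.single i 1)

/-- `D_I φ = ∑_{i ∈ I} ∂ᵢ φ / ∏_{j ∈ I, j ≠ i} (x_j - x_i)`; meaningful at points where the
coordinates `x_i`, `i ∈ I`, are distinct. -/
def DI {N : ℕ} (I : Finset (Fin N)) (φ : (Fin N → ℝ) → ℝ) (x : Fin N → ℝ) : ℝ :=
  ∑ i ∈ I, partialDeriv i φ x / ∏ j ∈ I.erase i, (x j - x i)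

/-- `D_d φ = d! ∑_{|I| = d} D_I φ`; meaningful at points with distinct coordinates. -/
def D {N : ℕ} (d : ℕ) (φ : (Fin N → ℝ) → ℝ) (x : Fin N → ℝ) : ℝ :=
  (d.factorial : ℝ) * ∑ I ∈ (Finset.univ : Finset (Fin N)).powersetCard d, DI I φ x

/-- The value at `x` of the partial derivative `∂_{ι 0} ⋯ ∂_{ι (g-1)} φ` of order `g`. -/
def mixedDeriv {N g : ℕ} (ι : Fin g → Fin N) (φ : (Fin N → ℝ) → ℝ) (x : Fin N → ℝ) : ℝ :=
  iteratedFDeriv ℝ g φ x (fun q => Pi.single (ι q) 1)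

/-- The multiset of the multiplicities with which the values of `ι` are attained. -/
def pattern {N g : ℕ} (ι : Fin g → Fin N) : Multiset ℕ :=
  (Finset.univ.image ι).val.map (fun i => (Finset.univ.filter (fun q => ι q = i)).card)

/-- The index tuples `ι` with all entries in `J` whose multiplicities form the partition `σ`. -/
def assignments {N g : ℕ} (J : Finset (Fin N)) (σ : g.Partition) : Finset (Fin g → Fin N) :=
  Finset.univ.filter (fun ι => (∀ q, ι q ∈ J) ∧ pattern ι = σ.parts)

/-- `∂_J^σ φ` at `x`: the derivative in which the parts of `σ` are assigned, as orders of
differentiation, to distinct indices from `J`. It is averaged over all the assignments, which all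
give the same value when `φ` is symmetric (and regular enough) and the `x_i`, `i ∈ J`, coincide.
If `σ` has more than `|J|` parts then there are no assignments, and the value is `0`. -/
def partitionDeriv {N g : ℕ} (J : Finset (Fin N)) (σ : g.Partition)
    (φ : (Fin N → ℝ) → ℝ) (x : Fin N → ℝ) : ℝ :=
  (∑ ι ∈ assignments J σ, mixedDeriv ι φ x) / ((assignments J σ).card : ℝ)

/-- The coefficient `(-1)^{g-l(σ)} g (l(σ)-1)! / ∏_{h=1}^g h!^{m_h} m_h!`, where `l(σ)` is the
number of parts of `σ` and `m_h` is the multiplicity of `h` in `σ`. -/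
def partitionCoeff {g : ℕ} (σ : g.Partition) : ℝ :=
  (-1 : ℝ) ^ (g - σ.parts.card) * ((g : ℝ) * ((σ.parts.card - 1).factorial : ℝ)) /
    ∏ h ∈ Finset.Icc 1 g,
      ((h.factorial : ℝ) ^ (σ.parts.count h) * ((σ.parts.count h).factorial : ℝ))

/-- The combination `∂_J^g φ` at `x` of the derivatives `∂_J^σ φ` over all partitions `σ` of `g`
(used for `1 ≤ g ≤ |J|`). -/
def blockDeriv {N : ℕ} (J : Finset (Fin N)) (g : ℕ)
    (φ : (Fin N → ℝ) → ℝ) (x : Fin N → ℝ) : ℝ :=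
  ∑ σ : g.Partition, partitionCoeff σ * partitionDeriv J σ φ x

/-- The tuples `c = (c_β)_{β ≠ α}` of non-negative integers with `∑ c_β < d` (this inequality
forces each entry to be less than `d`). -/
def exponents {M : ℕ} (d : ℕ) (α : Fin M) : Finset ({β : Fin M // β ≠ α} → ℕ) :=
  (Fintype.piFinset (fun _ => Finset.range d)).filter (fun c => ∑ β, c β < d)

/-- The set `Ξ_{α,c}` of tuples `κ` with `κ_β = 0` if `c_β = 0` and `1 ≤ κ_β ≤ c_β` if
`c_β > 0`. -/
def Xi {M : ℕ} (α : Fin M) (c : {β : Fin M // β ≠ α} → ℕ) :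
    Finset ({β : Fin M // β ≠ α} → ℕ) :=
  Fintype.piFinset (fun β => if c β = 0 then {0} else Finset.Icc 1 (c β))

/-- The coefficient `C_{α,c}`, where `s β` is the size of the block with index `β`. -/
def C {M : ℕ} (s : Fin M → ℕ) (d : ℕ) (α : Fin M) (c : {β : Fin M // β ≠ α} → ℕ) : ℤ :=
  ∑ κ ∈ Xi α c,
    (-1 : ℤ) ^ (∑ β, (c β - κ β)) * ((s α).choose (d - ∑ β, κ β) : ℤ) *
      ∏ β ∈ Finset.univ.filter (fun β => 0 < c β),
        (((c β - 1).choose (κ β - 1) : ℤ) * ((s β).choose (κ β) : ℤ))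

end SymmDeriv

end

/-! `DI I φ z` is, up to sign, a divided difference of the data `∂ᵢφ(z)` at the nodes `z i`, so it
obeys the two-term recurrence `sub_mul_dividedDiff`. The limit is found first for nodes that all
merge, then for nodes in several clusters.

One cluster. For symmetric `φ` the two terms of the recurrence are one function evaluated at `z` and
at `z` with two coordinates exchanged. These points differ by `z b - z a` times a fixed vector, so
the fundamental theorem of calculus cancels the denominator. Iterating this writes `D_J φ` as an
integral of derivatives of order `|J|` at points linear in `z` (`exists_integral_representation`).
Dominated convergence gives a limit `∑ c ι ∂_ι φ(x)` whose weights `c` depend only on `J`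
(`exists_tendsto_DI`). Since they are universal, the weights can be found by testing: at the origin,
an augmented monomial of type `σ` isolates the total weight of the index tuples of pattern `σ`, and
the limit of its `D_J` follows from power sums and the Leibniz rule (`tendsto_DI_augMonomial`). At
`x`, tuples of equal pattern give equal derivatives, so these totals suffice and the limit is
`blockDeriv` (`tendsto_DI_blockDeriv`).

Several clusters. The numerators are split according to the block of their index. For block `α`, the
recurrence applied to one node inside and one node outside has a denominator with nonzero limit. Its
solution is a coefficient of `B * ∏ w i`, where `B` generates the one-cluster limits and a node of
block `β` outside contributes `ΔX / (1 + ΔX)` with `Δ = 1 / (y β - y α)`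
(`tendsto_dividedDiff_ite`). Summing over `|I| = d` extracts the coefficient of `Y ^ d` from `∏ (1 +
w i Y)`; expanding blockwise in `X` produces the constants `C` (`sum_powersetCard_coeff`). -/

open MeasureTheory

namespace SymmDeriv

/-! ### Divided differences and their recurrence. -/

/-- The divided difference of the data `F` at the nodes `z i`, `i ∈ I`, up to the sign
`(-1) ^ (|I| - 1)`. -/
noncomputable def dividedDiff {N : ℕ} (I : Finset (Fin N)) (F z : Fin N → ℝ) : ℝ :=
  ∑ i ∈ I, F i / ∏ j ∈ I.erase i, (z j - z i)

theorem DI_eq_dividedDiff {N : ℕ} (I : Finset (Fin N)) (φ : (Fin N → ℝ) → ℝ) (z : Fin N → ℝ) :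
    DI I φ z = dividedDiff I (fun i => partialDeriv i φ z) z := rfl

theorem dividedDiff_insert {N : ℕ} {I : Finset (Fin N)} {a : Fin N} (ha : a ∉ I)
    (F z : Fin N → ℝ) :
    dividedDiff (insert a I) F z = F a / ∏ j ∈ I, (z j - z a) +
      ∑ i ∈ I, F i / ((z a - z i) * ∏ j ∈ I.erase i, (z j - z i)) := by
  unfold dividedDiff
  rw [Finset.sum_insert ha, Finset.erase_insert ha]
  congr 1
  refine Finset.sum_congr rfl fun i hi => ?_
  have hne : a ≠ i := fun h => ha (h ▸ hi)
  rw [Finset.erase_insert_of_ne hne, Finset.prod_insert]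
  exact fun h => ha (Finset.mem_of_mem_erase h)

/-- Termwise this is the partial fraction identity `(z b - z a) / ((z a - z i) (z b - z i)) = 1 / (z
a - z i) - 1 / (z b - z i)`. Every limit below is reached through this recurrence. -/
theorem sub_mul_dividedDiff {N : ℕ} {S : Finset (Fin N)} {a b : Fin N} (hab : a ≠ b)
    (ha : a ∉ S) (hb : b ∉ S) (F : Fin N → ℝ) {z : Fin N → ℝ} (hz : Function.Injective z) :
    (z b - z a) * dividedDiff (insert a (insert b S)) F z =
      dividedDiff (insert a S) F z - dividedDiff (insert b S) F z := by
  have hne : ∀ {i j : Fin N}, i ≠ j → z i - z j ≠ 0 := fun h =>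
    sub_ne_zero.2 (fun h' => h (hz h'))
  have hab' : a ∉ insert b S := by simp [hab, ha]
  rw [dividedDiff_insert hab', dividedDiff_insert ha, dividedDiff_insert hb,
    Finset.sum_insert hb, Finset.prod_insert hb, Finset.erase_insert hb, mul_add, mul_add,
    Finset.mul_sum]
  have h1 := hne hab
  have h2 := hne hab.symm
  have hP : ∀ c, c ∉ S → ∏ j ∈ S, (z j - z c) ≠ 0 := fun c hc =>
    Finset.prod_ne_zero_iff.2 fun j hj => hne (fun h => hc (h ▸ hj))
  have hPa := hP a ha
  have hPb := hP b hb
  have hsum : ∑ i ∈ S, (z b - z a) *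
      (F i / ((z a - z i) * ∏ j ∈ (insert b S).erase i, (z j - z i))) =
      ∑ i ∈ S, F i / ((z a - z i) * ∏ j ∈ S.erase i, (z j - z i)) -
      ∑ i ∈ S, F i / ((z b - z i) * ∏ j ∈ S.erase i, (z j - z i)) := by
    rw [← Finset.sum_sub_distrib]
    refine Finset.sum_congr rfl fun i hi => ?_
    have hbi : b ≠ i := fun h => hb (h ▸ hi)
    have hai : a ≠ i := fun h => ha (h ▸ hi)
    rw [Finset.erase_insert_of_ne hbi, Finset.prod_insert
      (fun h => hb (Finset.mem_of_mem_erase h))]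
    have h3 := hne hbi
    have h4 := hne hai
    have h5 : ∏ j ∈ S.erase i, (z j - z i) ≠ 0 :=
      Finset.prod_ne_zero_iff.2 fun j hj => hne (Finset.ne_of_mem_erase hj)
    field_simp
    ring
  rw [hsum]
  have e1 : (z b - z a) * (F a / ((z b - z a) * ∏ j ∈ S, (z j - z a))) =
      F a / ∏ j ∈ S, (z j - z a) := by field_simp
  have e2 : (z b - z a) * (F b / ((z a - z b) * ∏ j ∈ S, (z j - z b))) =
      - (F b / ∏ j ∈ S, (z j - z b)) := by
    field_simp
    ring
  rw [e1, e2]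
  ring

/-! ### Symmetric functions under permutation of coordinates. -/

/-- Permutation of the coordinates, as a continuous linear equivalence. -/
noncomputable def permCoord {N : ℕ} (π : Equiv.Perm (Fin N)) : (Fin N → ℝ) ≃L[ℝ] (Fin N → ℝ) :=
  (LinearEquiv.funCongrLeft ℝ ℝ π).toContinuousLinearEquiv

@[simp] theorem permCoord_apply {N : ℕ} (π : Equiv.Perm (Fin N)) (z : Fin N → ℝ) :
    permCoord π z = z ∘ π := rfl

theorem single_comp_perm {N : ℕ} (π : Equiv.Perm (Fin N)) (i : Fin N) :
    (Pi.single (π i) (1 : ℝ) : Fin N → ℝ) ∘ π = Pi.single i 1 := by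
  ext j
  simp [Pi.single_apply]

theorem IsSymmetric.comp_permCoord {N : ℕ} {φ : (Fin N → ℝ) → ℝ} (hφ : IsSymmetric φ)
    (π : Equiv.Perm (Fin N)) : φ ∘ permCoord π = φ := by
  ext z
  exact hφ π z

theorem IsSymmetric.partialDeriv_comp {N : ℕ} {φ : (Fin N → ℝ) → ℝ} (hφ : IsSymmetric φ)
    (π : Equiv.Perm (Fin N)) (i : Fin N) (z : Fin N → ℝ) :
    partialDeriv i φ (z ∘ π) = partialDeriv (π i) φ z := by
  unfold partialDeriv
  conv_rhs => rw [← hφ.comp_permCoord π, ContinuousLinearEquiv.comp_right_fderiv]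
  simp [single_comp_perm]

theorem IsSymmetric.mixedDeriv_comp {N g : ℕ} {φ : (Fin N → ℝ) → ℝ} (hφ : IsSymmetric φ)
    (π : Equiv.Perm (Fin N)) (ι : Fin g → Fin N) (z : Fin N → ℝ) :
    mixedDeriv (π ∘ ι) φ z = mixedDeriv ι φ (z ∘ π) := by
  unfold mixedDeriv
  have h := (permCoord π).iteratedFDerivWithin_comp_right φ uniqueDiffOn_univ
    (Set.mem_univ (permCoord π z)) g
  rw [Set.preimage_univ, iteratedFDerivWithin_univ, iteratedFDerivWithin_univ,
    hφ.comp_permCoord π] at h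
  simp [h, single_comp_perm]

/-- This turns a difference of `DI` over two index sets into a difference of one function at two
points. -/
theorem IsSymmetric.DI_comp {N : ℕ} {φ : (Fin N → ℝ) → ℝ} (hφ : IsSymmetric φ)
    (π : Equiv.Perm (Fin N)) (I : Finset (Fin N)) (z : Fin N → ℝ) :
    DI I φ (z ∘ π) = DI (I.map π.toEmbedding) φ z := by
  unfold DI
  rw [Finset.sum_map]
  refine Finset.sum_congr rfl fun i _ => ?_
  rw [hφ.partialDeriv_comp]
  have : (I.map π.toEmbedding).erase (π.toEmbedding i) = (I.erase i).map π.toEmbedding := by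
    rw [Finset.map_erase]
  rw [this, Finset.prod_map]
  rfl

/-! ### Symmetry of higher derivatives. -/

/-- The derivative of order `n` of a function of class `C^n` over the reals is symmetric. -/
theorem iteratedFDeriv_comp_swap {E : Type*} [NormedAddCommGroup E] [NormedSpace ℝ E]
    {f : E → ℝ} : ∀ {n : ℕ} (i : Fin n) {x : E}, ContDiffAt ℝ ((n + 1 : ℕ) : WithTop ℕ∞) f x →
    ∀ v : Fin (n + 1) → E, iteratedFDeriv ℝ (n + 1) f x (v ∘ Equiv.swap i.castSucc i.succ) =
      iteratedFDeriv ℝ (n + 1) f x v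
  | 0, i, _, _, _ => i.elim0
  | n + 1, i, x, hf, v => by
    have hd : DifferentiableAt ℝ (iteratedFDeriv ℝ (n + 1) f) x :=
      hf.differentiableAt_iteratedFDeriv (by exact_mod_cast Nat.lt_succ_self _)
    induction i using Fin.cases with
    | zero =>
      -- The first two slots are the second derivative of the derivative of order `n`, where
      -- Schwarz's theorem applies.
      have hsymm : IsSymmSndFDerivAt ℝ (iteratedFDeriv ℝ n f) x := by
        refine ContDiffAt.isSymmSndFDerivAt (n := 2) ?_ (by simp)
        exact hf.iteratedFDeriv_right (by push_cast; rw [add_assoc, add_comm]; norm_num)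
      have key : ∀ w : Fin (n + 2) → E, iteratedFDeriv ℝ (n + 2) f x w =
          fderiv ℝ (fderiv ℝ (iteratedFDeriv ℝ n f)) x (w 0) (w 1) (Fin.tail (Fin.tail w)) := by
        intro w
        rw [hd.iteratedFDeriv_succ_apply_left']
        have e : (fun y => iteratedFDeriv ℝ (n + 1) f y (Fin.tail w)) =
            fun y => fderiv ℝ (iteratedFDeriv ℝ n f) y (w 1) (Fin.tail (Fin.tail w)) := by
          ext y
          rw [iteratedFDeriv_succ_apply_left]
          rfl
        have h1 : ContDiffAt ℝ 1 (fderiv ℝ (iteratedFDeriv ℝ n f)) x := by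
          have : ContDiffAt ℝ 2 (iteratedFDeriv ℝ n f) x :=
            hf.iteratedFDeriv_right (by push_cast; rw [add_assoc, add_comm]; norm_num)
          exact this.fderiv_right (by norm_num)
        have h2 : DifferentiableAt ℝ (fderiv ℝ (iteratedFDeriv ℝ n f)) x :=
          h1.differentiableAt (by norm_num)
        rw [e, fderiv_continuousMultilinear_apply_const (h2.clm_apply (by fun_prop)),
          fderiv_clm_apply h2 (by fun_prop)]
        simp
      rw [key, key]
      have e1 : Fin.tail (Fin.tail (v ∘ Equiv.swap (Fin.castSucc 0) (Fin.succ 0))) =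
          Fin.tail (Fin.tail v) := by
        ext q
        have : Equiv.swap (0 : Fin (n + 2)) 1 q.succ.succ = q.succ.succ := by
          apply Equiv.swap_apply_of_ne_of_ne
          · exact Fin.succ_ne_zero _
          · rw [← Fin.succ_zero_eq_one]
            exact fun h => Fin.succ_ne_zero _ (Fin.succ_injective _ h)
        simp [Fin.tail, this]
      rw [e1, hsymm.eq]
      simp
    | succ i =>
      -- A later transposition leaves slot `0` alone: the identity of lower order holds near `x`,
      -- hence can be differentiated.
      have hev : ∀ᶠ y in 𝓝 x, ContDiffAt ℝ ((n + 1 : ℕ) : WithTop ℕ∞) f y :=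
        (hf.of_le (by exact_mod_cast Nat.le_succ _)).eventually (by simp)
      rw [hd.iteratedFDeriv_succ_apply_left', hd.iteratedFDeriv_succ_apply_left']
      have e0 : (v ∘ Equiv.swap i.succ.castSucc i.succ.succ) 0 = v 0 := by
        rw [Function.comp_apply, Equiv.swap_apply_of_ne_of_ne]
        · exact fun h => Fin.succ_ne_zero i (Fin.castSucc_injective _ h.symm)
        · exact (Fin.succ_ne_zero _).symm
      have e1 : Fin.tail (v ∘ Equiv.swap i.succ.castSucc i.succ.succ) =
          Fin.tail v ∘ Equiv.swap i.castSucc i.succ := by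
        ext1 q
        simp only [Fin.tail, Function.comp_apply]
        rw [← Fin.succ_castSucc, (Fin.succ_injective _).map_swap]
      rw [e0, e1, Filter.EventuallyEq.fderiv_eq]
      filter_upwards [hev] with y hy
      exact iteratedFDeriv_comp_swap i hy _

theorem iteratedFDeriv_comp_perm {E : Type*} [NormedAddCommGroup E] [NormedSpace ℝ E]
    {f : E → ℝ} {n : ℕ} {x : E} (hf : ContDiffAt ℝ (n : WithTop ℕ∞) f x)
    (v : Fin n → E) (π : Equiv.Perm (Fin n)) :
    iteratedFDeriv ℝ n f x (v ∘ π) = iteratedFDeriv ℝ n f x v := by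
  cases n with
  | zero => rw [Subsingleton.elim (v ∘ π) v]
  | succ n =>
    have hπ : π ∈ Submonoid.closure
        (Set.range fun i : Fin n => Equiv.swap i.castSucc i.succ) := by
      rw [Equiv.Perm.mclosure_swap_castSucc_succ]
      trivial
    induction hπ using Submonoid.closure_induction generalizing v with
    | mem π h =>
      obtain ⟨i, rfl⟩ := h
      exact iteratedFDeriv_comp_swap i hf v
    | one => rfl
    | mul π ρ _ _ h1 h2 =>
      rw [Equiv.Perm.coe_mul, ← Function.comp_assoc, h2, h1]

/-! ### The integral representation of `D_J φ` and its limit. -/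

/-- The convex combination `(1 - s) z + s (z ∘ π)`, as a linear map in `z`. -/
noncomputable def mixCoord {N : ℕ} (π : Equiv.Perm (Fin N)) (s : ℝ) :
    (Fin N → ℝ) →L[ℝ] (Fin N → ℝ) :=
  (1 - s) • ContinuousLinearMap.id ℝ _ + s • (permCoord π : (Fin N → ℝ) →L[ℝ] (Fin N → ℝ))

theorem mixCoord_apply {N : ℕ} (π : Equiv.Perm (Fin N)) (s : ℝ) (z : Fin N → ℝ) :
    mixCoord π s z = (1 - s) • z + s • (z ∘ π) := rfl

theorem continuous_mixCoord {N : ℕ} (π : Equiv.Perm (Fin N)) : Continuous (mixCoord π) := by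
  unfold mixCoord
  fun_prop

theorem norm_comp_perm_le {N : ℕ} (π : Equiv.Perm (Fin N)) (z : Fin N → ℝ) : ‖z ∘ π‖ ≤ ‖z‖ :=
  (pi_norm_le_iff_of_nonneg (norm_nonneg z)).2 fun i => norm_le_pi_norm z (π i)

/-- Being a contraction, the map preserves every ball centred at a point it fixes, so the evaluation
points stay where `φ` is regular. -/
theorem norm_mixCoord_le {N : ℕ} (π : Equiv.Perm (Fin N)) {s : ℝ} (h0 : 0 ≤ s) (h1 : s ≤ 1)
    (z : Fin N → ℝ) : ‖mixCoord π s z‖ ≤ ‖z‖ := by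
  rw [mixCoord_apply]
  calc ‖(1 - s) • z + s • (z ∘ π)‖ ≤ ‖(1 - s) • z‖ + ‖s • (z ∘ π)‖ := norm_add_le _ _
    _ = (1 - s) * ‖z‖ + s * ‖z ∘ π‖ := by
      rw [norm_smul, norm_smul, Real.norm_of_nonneg h0, Real.norm_of_nonneg (by linarith)]
    _ ≤ (1 - s) * ‖z‖ + s * ‖z‖ := by gcongr; exact norm_comp_perm_le π z
    _ = ‖z‖ := by ring

/-- The scalar `z b - z a` is exactly the denominator to be cancelled. -/
theorem sub_comp_swap {N : ℕ} {a b : Fin N} (hab : a ≠ b) (z : Fin N → ℝ) :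
    z - z ∘ Equiv.swap a b = (z b - z a) • (Pi.single b 1 - Pi.single a 1 : Fin N → ℝ) := by
  ext i
  by_cases ha : i = a
  · subst ha
    simp [hab]
  · by_cases hb : i = b
    · subst hb
      simp [ha]
    · simp [ha, hb, Equiv.swap_apply_of_ne_of_ne ha hb]

/-- The fundamental theorem of calculus for a derivative of order `k`, along the segment joining
`z` to a point obtained by exchanging two coordinates. -/
theorem integral_iteratedFDeriv_mixCoord {N k : ℕ} {φ : (Fin N → ℝ) → ℝ} {U : Set (Fin N → ℝ)}
    (hU : IsOpen U) (hφ : ContDiffOn ℝ ((k + 1 : ℕ) : WithTop ℕ∞) φ U)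
    {a b : Fin N} (hab : a ≠ b) (R : (Fin N → ℝ) →L[ℝ] (Fin N → ℝ)) (V : Fin k → (Fin N → ℝ))
    {z : Fin N → ℝ}
    (hz : ∀ s ∈ Set.Icc (0 : ℝ) 1, R (mixCoord (Equiv.swap a b) s z) ∈ U) :
    iteratedFDeriv ℝ k φ (R z) V - iteratedFDeriv ℝ k φ (R (z ∘ Equiv.swap a b)) V =
      (z b - z a) * ∫ s in (0 : ℝ)..1,
        iteratedFDeriv ℝ (k + 1) φ (R (mixCoord (Equiv.swap a b) s z))
          (Fin.cons (R (Pi.single b 1 - Pi.single a 1)) V : Fin (k + 1) → (Fin N → ℝ)) := by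
  set τ := Equiv.swap a b
  set w : Fin N → ℝ := Pi.single b 1 - Pi.single a 1
  set W : Fin (k + 1) → (Fin N → ℝ) := Fin.cons (R w) V
  have hcont : ContinuousOn (fun s => iteratedFDeriv ℝ (k + 1) φ (R (mixCoord τ s z)) W)
      (Set.Icc 0 1) := by
    have h1 : ContinuousOn (iteratedFDeriv ℝ (k + 1) φ) U :=
      (hφ.continuousOn_iteratedFDerivWithin le_rfl hU.uniqueDiffOn).congr
        fun y hy => (iteratedFDerivWithin_of_isOpen _ hU hy).symm
    have h2 : Continuous fun s => R (mixCoord τ s z) :=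
      R.continuous.comp ((continuous_mixCoord τ).clm_apply continuous_const)
    have h3 := h1.comp h2.continuousOn hz
    exact (ContinuousMultilinearMap.apply ℝ (fun _ : Fin (k + 1) => (Fin N → ℝ)) ℝ W
      ).continuous.comp_continuousOn h3
  have hderiv : ∀ s ∈ Set.uIcc (0 : ℝ) 1,
      HasDerivAt (fun s => iteratedFDeriv ℝ k φ (R (mixCoord τ s z)) V)
        (-(z b - z a) * iteratedFDeriv ℝ (k + 1) φ (R (mixCoord τ s z)) W) s := by
    intro s hs
    rw [Set.uIcc_of_le zero_le_one] at hs
    have hat : ContDiffAt ℝ ((k + 1 : ℕ) : WithTop ℕ∞) φ (R (mixCoord τ s z)) :=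
      hφ.contDiffAt (hU.mem_nhds (hz s hs))
    have hd : DifferentiableAt ℝ (iteratedFDeriv ℝ k φ) (R (mixCoord τ s z)) :=
      hat.differentiableAt_iteratedFDeriv (by exact_mod_cast Nat.lt_succ_self _)
    have hd' : HasFDerivAt (fun y => iteratedFDeriv ℝ k φ y V)
        ((ContinuousMultilinearMap.apply ℝ (fun _ : Fin k => (Fin N → ℝ)) ℝ V).comp
          (fderiv ℝ (iteratedFDeriv ℝ k φ) (R (mixCoord τ s z)))) (R (mixCoord τ s z)) :=
      (ContinuousMultilinearMap.apply ℝ (fun _ : Fin k => (Fin N → ℝ)) ℝ V).hasFDerivAt.comp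
        (R (mixCoord τ s z)) hd.hasFDerivAt
    have hpath : HasDerivAt (fun s => R (mixCoord τ s z)) (R (z ∘ τ - z)) s := by
      apply R.hasFDerivAt.comp_hasDerivAt
      simp only [mixCoord_apply]
      have h1 : HasDerivAt (fun s : ℝ => (1 - s) • z) ((-1 : ℝ) • z) s :=
        ((hasDerivAt_id s).const_sub 1).smul_const z
      have h2 : HasDerivAt (fun s : ℝ => s • (z ∘ τ)) ((1 : ℝ) • (z ∘ τ)) s :=
        (hasDerivAt_id s).smul_const (z ∘ τ)
      have h3 := h1.add h2
      rwa [show (-1 : ℝ) • z + (1 : ℝ) • (z ∘ τ) = z ∘ τ - z by module] at h3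
    have h := hd'.comp_hasDerivAt s hpath
    refine h.congr_deriv ?_
    rw [iteratedFDeriv_succ_apply_left]
    have e : z ∘ τ - z = (-(z b - z a)) • w := by
      rw [neg_smul, ← sub_comp_swap hab, neg_sub]
    rw [e]
    simp [W]
  have hint : IntervalIntegrable
      (fun s => -(z b - z a) * iteratedFDeriv ℝ (k + 1) φ (R (mixCoord τ s z)) W)
      volume 0 1 := by
    apply ContinuousOn.intervalIntegrable
    rw [Set.uIcc_of_le zero_le_one]
    exact continuousOn_const.mul hcont
  have h := intervalIntegral.integral_eq_sub_of_hasDerivAt hderiv hint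
  rw [intervalIntegral.integral_const_mul] at h
  have e0 : mixCoord τ 0 z = z := by simp [mixCoord_apply]
  have e1 : mixCoord τ 1 z = z ∘ τ := by simp [mixCoord_apply]
  rw [e0, e1] at h
  linarith

theorem integral_unitInterval (f : ℝ → ℝ) :
    ∫ s : unitInterval, f s = ∫ s in (0 : ℝ)..1, f s := by
  rw [intervalIntegral.integral_of_le zero_le_one, ← integral_Icc_eq_integral_Ioc]
  exact integral_subtype_comap measurableSet_Icc f

/-- For a symmetric function `φ`, `D_J φ` is an average of derivatives of order `|J|`, taken at
points which depend linearly on `z`. -/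
theorem exists_integral_representation {N : ℕ} (k : ℕ) :
    ∀ J : Finset (Fin N), J.card = k + 1 →
    ∃ (Ω : Type) (_ : TopologicalSpace Ω) (_ : CompactSpace Ω) (_ : SecondCountableTopology Ω)
      (_ : MeasurableSpace Ω) (_ : BorelSpace Ω) (μ : Measure Ω) (_ : IsFiniteMeasure μ)
      (R : Ω → ((Fin N → ℝ) →L[ℝ] (Fin N → ℝ))) (V : Ω → Fin (k + 1) → (Fin N → ℝ)),
      Continuous R ∧ Continuous V ∧ (∀ ω v, ∀ i ∉ J, R ω v i = v i) ∧
      (∀ ω q, ∀ i ∉ J, V ω q i = 0) ∧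
      (∀ ω x, (∀ i ∈ J, ∀ j ∈ J, x i = x j) → R ω x = x) ∧ (∀ ω v, ‖R ω v‖ ≤ ‖v‖) ∧
      ∀ φ : (Fin N → ℝ) → ℝ, IsSymmetric φ → ∀ x : Fin N → ℝ, (∀ i ∈ J, ∀ j ∈ J, x i = x j) →
        ∀ r : ℝ, ContDiffOn ℝ ((k + 1 : ℕ) : WithTop ℕ∞) φ (Metric.ball x r) →
        ∀ z ∈ Metric.ball x r, Function.Injective z →
        DI J φ z = ∫ ω, iteratedFDeriv ℝ (k + 1) φ (R ω z) (V ω) ∂μ := by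
  induction k with
  | zero =>
    intro J hJ
    obtain ⟨a, rfl⟩ := Finset.card_eq_one.1 hJ
    refine ⟨Unit, inferInstance, inferInstance, inferInstance, inferInstance, inferInstance,
      Measure.dirac (), inferInstance, fun _ => ContinuousLinearMap.id ℝ _,
      fun _ _ => Pi.single a 1, continuous_const, continuous_const, ?_, ?_, ?_, ?_, ?_⟩
    · simp
    · intro _ _ i hi
      simp only [Finset.mem_singleton] at hi
      simp [hi]
    · simp
    · simp
    · intro φ _ x _ r _ z _ _
      simp [DI, partialDeriv, iteratedFDeriv_one_apply]
  | succ k ih =>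
    intro J hJ
    obtain ⟨b, T, hbT, rfl, hT⟩ := Finset.card_eq_succ.1 hJ
    obtain ⟨a, S, haS, rfl, hS⟩ := Finset.card_eq_succ.1 hT
    have hab : a ≠ b := fun h => hbT (h ▸ Finset.mem_insert_self a S)
    have hbS : b ∉ S := fun h => hbT (Finset.mem_insert_of_mem h)
    obtain ⟨Ω, _, _, _, _, _, μ, _, R, V, hR, hV, hRJ, hVJ, hRx, hRn, hrep⟩ :=
      ih (insert a S) (by rw [Finset.card_insert_of_notMem haS, hS])
    set τ := Equiv.swap a b
    -- Each added node contributes one integration over `[0, 1]`, along the segment from `z` to `z ∘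
    -- τ`, and one new direction, the image under `R` of the direction of that segment.
    refine ⟨Ω × unitInterval, inferInstance, inferInstance, inferInstance, inferInstance,
      inferInstance, μ.prod volume, inferInstance,
      fun p => (R p.1).comp (mixCoord τ p.2),
      fun p => Fin.cons (R p.1 (Pi.single b 1 - Pi.single a 1)) (V p.1), ?_, ?_, ?_, ?_, ?_, ?_,
      ?_⟩
    · exact (hR.comp continuous_fst).clm_comp
        ((continuous_mixCoord τ).comp (continuous_subtype_val.comp continuous_snd))
    · refine continuous_pi fun q => ?_
      induction q using Fin.cases with
      | zero => exact (hR.comp continuous_fst).clm_apply continuous_const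
      | succ q => exact (continuous_apply q).comp (hV.comp continuous_fst)
    · intro p v i hi
      have h1 : i ∉ insert a S := fun h => hi (Finset.mem_insert_of_mem h)
      have h2 : i ≠ a := fun h => h1 (h ▸ Finset.mem_insert_self _ _)
      have h3 : i ≠ b := fun h => hi (h ▸ Finset.mem_insert_self _ _)
      rw [ContinuousLinearMap.comp_apply, hRJ _ _ _ h1, mixCoord_apply]
      simp [τ, Equiv.swap_apply_of_ne_of_ne h2 h3]
      ring
    · intro p q i hi
      have h1 : i ∉ insert a S := fun h => hi (Finset.mem_insert_of_mem h)
      have h2 : i ≠ a := fun h => h1 (h ▸ Finset.mem_insert_self _ _)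
      have h3 : i ≠ b := fun h => hi (h ▸ Finset.mem_insert_self _ _)
      induction q using Fin.cases with
      | zero => simp [hRJ _ _ _ h1, h2, h3]
      | succ q => simp [hVJ _ _ _ h1]
    · intro p x hx
      have hxτ : x ∘ τ = x := by
        ext i
        by_cases h2 : i = a
        · subst h2
          simpa [τ] using hx b (by simp) i (by simp)
        · by_cases h3 : i = b
          · subst h3
            simpa [τ] using hx a (by simp) i (by simp)
          · simp [τ, Equiv.swap_apply_of_ne_of_ne h2 h3]
      have : mixCoord τ (p.2 : ℝ) x = x := by
        rw [mixCoord_apply, hxτ]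
        module
      rw [ContinuousLinearMap.comp_apply, this]
      exact hRx _ _ fun i hi j hj =>
        hx i (Finset.mem_insert_of_mem hi) j (Finset.mem_insert_of_mem hj)
    · intro p v
      exact (hRn _ _).trans (norm_mixCoord_le τ p.2.2.1 p.2.2.2 v)
    · intro φ hφ x hx r hC z hz hzi
      have hxS : ∀ i ∈ insert a S, ∀ j ∈ insert a S, x i = x j := fun i hi j hj =>
        hx i (Finset.mem_insert_of_mem hi) j (Finset.mem_insert_of_mem hj)
      have hxτ : x ∘ τ = x := by
        ext i
        by_cases h2 : i = a
        · subst h2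
          simpa [τ] using hx b (by simp) i (by simp)
        · by_cases h3 : i = b
          · subst h3
            simpa [τ] using hx a (by simp) i (by simp)
          · simp [τ, Equiv.swap_apply_of_ne_of_ne h2 h3]
      have hmix : ∀ s ∈ Set.Icc (0 : ℝ) 1, mixCoord τ s z ∈ Metric.ball x r := by
        intro s hs
        have hmx : mixCoord τ s x = x := by
          rw [mixCoord_apply, hxτ]
          module
        rw [mem_ball_iff_norm] at hz ⊢
        calc ‖mixCoord τ s z - x‖ = ‖mixCoord τ s (z - x)‖ := by rw [map_sub, hmx]
          _ ≤ ‖z - x‖ := norm_mixCoord_le τ hs.1 hs.2 _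
          _ < r := hz
      have hRball : ∀ ω, ∀ v ∈ Metric.ball x r, R ω v ∈ Metric.ball x r := by
        intro ω v hv
        rw [mem_ball_iff_norm] at hv ⊢
        calc ‖R ω v - x‖ = ‖R ω (v - x)‖ := by rw [map_sub, hRx ω x hxS]
          _ ≤ ‖v - x‖ := hRn _ _
          _ < r := hv
      have hzτ : z ∘ τ ∈ Metric.ball x r := by
        have := hmix 1 (by simp)
        rwa [mixCoord_apply, sub_self, zero_smul, one_smul, zero_add] at this
      have hC' : ContDiffOn ℝ ((k + 1 : ℕ) : WithTop ℕ∞) φ (Metric.ball x r) :=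
        hC.of_le (by exact_mod_cast Nat.le_succ _)
      have hJmap : (insert a S).map τ.toEmbedding = insert b S := by
        rw [Finset.map_insert]
        congr 1
        · exact Equiv.swap_apply_left a b
        · ext i
          simp only [Finset.mem_map_equiv]
          by_cases h2 : i = a
          · subst h2
            simp [τ, haS, hbS]
          · by_cases h3 : i = b
            · subst h3
              simp [τ, haS, hbS]
            · simp [τ, Equiv.swap_apply_of_ne_of_ne h2 h3]
      -- The recurrence combined with symmetry: the index set `insert b S` is the image of `insert a
      -- S` under `τ`.
      have hdd : (z b - z a) * DI (insert b (insert a S)) φ z =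
          DI (insert a S) φ z - DI (insert a S) φ (z ∘ τ) := by
        rw [hφ.DI_comp, hJmap, Finset.insert_comm, DI_eq_dividedDiff,
          sub_mul_dividedDiff hab haS hbS _ hzi]
        rfl
      have hne : z b - z a ≠ 0 := sub_ne_zero.2 fun h => hab (hzi h).symm
      have hcontk : ∀ m : ℕ, m ≤ k + 1 + 1 →
          ContinuousOn (iteratedFDeriv ℝ m φ) (Metric.ball x r) := fun m hm =>
        (hC.continuousOn_iteratedFDerivWithin (by exact_mod_cast hm)
          Metric.isOpen_ball.uniqueDiffOn).congr
          fun y hy => (iteratedFDerivWithin_of_isOpen _ Metric.isOpen_ball hy).symm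
      have hintegr : ∀ v ∈ Metric.ball x r,
          Integrable (fun ω => iteratedFDeriv ℝ (k + 1) φ (R ω v) (V ω)) μ := by
        intro v hv
        have hc : Continuous fun ω => iteratedFDeriv ℝ (k + 1) φ (R ω v) := by
          have h1 : Continuous fun ω => R ω v := hR.clm_apply continuous_const
          exact (hcontk (k + 1) (by omega)).comp_continuous h1 fun ω => hRball ω v hv
        have hc2 : Continuous fun ω => iteratedFDeriv ℝ (k + 1) φ (R ω v) (V ω) :=
          ContinuousEval.continuous_eval.comp (hc.prodMk hV)
        exact hc2.integrable_of_hasCompactSupport (HasCompactSupport.of_compactSpace _)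
      apply mul_left_cancel₀ hne
      rw [hdd, hrep φ hφ x hxS r hC' z hz hzi,
        hrep φ hφ x hxS r hC' (z ∘ τ) hzτ (hzi.comp τ.injective),
        ← integral_sub (hintegr z hz) (hintegr _ hzτ), integral_prod, ← integral_const_mul]
      · refine integral_congr_ae (Filter.Eventually.of_forall fun ω => ?_)
        have h := integral_iteratedFDeriv_mixCoord Metric.isOpen_ball hC hab (R ω) (V ω)
          (z := z) (fun s hs => hRball ω _ (hmix s hs))
        rw [← integral_unitInterval] at h
        exact h
      · have hcR : Continuous fun p : Ω × unitInterval => R p.1 (mixCoord τ p.2 z) := by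
          refine (hR.comp continuous_fst).clm_apply ?_
          exact ((continuous_mixCoord τ).comp
            (continuous_subtype_val.comp continuous_snd)).clm_apply continuous_const
        have hc : Continuous fun p : Ω × unitInterval =>
            iteratedFDeriv ℝ (k + 1 + 1) φ (R p.1 (mixCoord τ p.2 z)) :=
          (hcontk (k + 1 + 1) le_rfl).comp_continuous hcR
            fun p => hRball _ _ (hmix _ p.2.2)
        have hcV : Continuous fun p : Ω × unitInterval =>
            (Fin.cons (R p.1 (Pi.single b 1 - Pi.single a 1)) (V p.1) :
              Fin (k + 1 + 1) → (Fin N → ℝ)) := by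
          refine continuous_pi fun q => ?_
          induction q using Fin.cases with
          | zero => exact (hR.comp continuous_fst).clm_apply continuous_const
          | succ q => exact (continuous_apply q).comp (hV.comp continuous_fst)
        exact (ContinuousEval.continuous_eval.comp (hc.prodMk hcV)
          ).integrable_of_hasCompactSupport (HasCompactSupport.of_compactSpace _)

/-- `D_J φ` has a limit at the points where the coordinates in `J` coincide: a fixed linear
combination of the derivatives of order `|J|`. -/
theorem exists_tendsto_DI {N k : ℕ} (J : Finset (Fin N)) (hJ : J.card = k + 1) :
    ∃ c : (Fin (k + 1) → Fin N) → ℝ, (∀ ι, (∃ q, ι q ∉ J) → c ι = 0) ∧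
      ∀ φ : (Fin N → ℝ) → ℝ, IsSymmetric φ → ∀ x : Fin N → ℝ, (∀ i ∈ J, ∀ j ∈ J, x i = x j) →
        ContDiffAt ℝ ((k + 1 : ℕ) : WithTop ℕ∞) φ x →
        Filter.Tendsto (fun z => DI J φ z) (𝓝[{z | Function.Injective z}] x)
          (𝓝 (∑ ι, c ι * mixedDeriv ι φ x)) := by
  obtain ⟨Ω, _, _, _, _, _, μ, _, R, V, hR, hV, hRJ, hVJ, hRx, hRn, hrep⟩ :=
    exists_integral_representation k J hJ
  have hVc : ∀ q i, Continuous fun ω => V ω q i := fun q i =>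
    (continuous_apply i).comp ((continuous_apply q).comp hV)
  -- These are the coefficients obtained by expanding the directions in the standard basis; neither
  -- `φ` nor `x` enters.
  refine ⟨fun ι => ∫ ω, ∏ q, V ω q (ι q) ∂μ, ?_, ?_⟩
  · rintro ι ⟨q, hq⟩
    rw [← integral_zero Ω ℝ (μ := μ)]
    refine integral_congr_ae (Filter.Eventually.of_forall fun ω => ?_)
    exact Finset.prod_eq_zero (Finset.mem_univ q) (hVJ ω q _ hq)
  intro φ hφ x hx hC
  obtain ⟨u, hu, hCu⟩ := hC.contDiffOn le_rfl (by simp)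
  obtain ⟨r, hr, hru⟩ := Metric.mem_nhds_iff.1 hu
  have hCr := hCu.mono hru
  have hcont : ContinuousOn (iteratedFDeriv ℝ (k + 1) φ) (Metric.ball x r) :=
    (hCr.continuousOn_iteratedFDerivWithin le_rfl Metric.isOpen_ball.uniqueDiffOn).congr
      fun y hy => (iteratedFDerivWithin_of_isOpen _ Metric.isOpen_ball hy).symm
  have hRball : ∀ s, ∀ ω, ∀ v ∈ Metric.ball x s, R ω v ∈ Metric.ball x s := by
    intro s ω v hv
    rw [mem_ball_iff_norm] at hv ⊢
    calc ‖R ω v - x‖ = ‖R ω (v - x)‖ := by rw [map_sub, hRx ω x hx]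
      _ ≤ ‖v - x‖ := hRn _ _
      _ < s := hv
  have hcx : ContinuousAt (iteratedFDeriv ℝ (k + 1) φ) x :=
    hcont.continuousAt (Metric.ball_mem_nhds x hr)
  have hlim : ∑ ι : Fin (k + 1) → Fin N, (∫ ω, ∏ q, V ω q (ι q) ∂μ) * mixedDeriv ι φ x =
      ∫ ω, iteratedFDeriv ℝ (k + 1) φ x (V ω) ∂μ := by
    have hexp : ∀ ω, iteratedFDeriv ℝ (k + 1) φ x (V ω) =
        ∑ ι : Fin (k + 1) → Fin N, (∏ q, V ω q (ι q)) * mixedDeriv ι φ x := by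
      intro ω
      have e : V ω = fun q => ∑ i, V ω q i • (Pi.single i 1 : Fin N → ℝ) := by
        ext1 q
        exact pi_eq_sum_univ' _
      conv_lhs => rw [e]
      rw [ContinuousMultilinearMap.map_sum]
      refine Finset.sum_congr rfl fun ι _ => ?_
      rw [ContinuousMultilinearMap.map_smul_univ]
      rfl
    simp_rw [hexp]
    rw [integral_finsetSum]
    · simp_rw [integral_mul_const]
    · intro ι _
      have : Continuous fun ω => (∏ q, V ω q (ι q)) * mixedDeriv ι φ x := by
        refine Continuous.mul ?_ continuous_const
        exact continuous_finsetProd _ fun q _ => hVc q _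
      exact this.integrable_of_hasCompactSupport (HasCompactSupport.of_compactSpace _)
  rw [hlim]
  have hev : ∀ᶠ z in 𝓝[{z | Function.Injective z}] x,
      DI J φ z = ∫ ω, iteratedFDeriv ℝ (k + 1) φ (R ω z) (V ω) ∂μ := by
    filter_upwards [self_mem_nhdsWithin,
      mem_nhdsWithin_of_mem_nhds (Metric.ball_mem_nhds x hr)] with z hzi hz
    exact hrep φ hφ x hx r hCr z hz hzi
  refine Filter.Tendsto.congr' (Filter.EventuallyEq.symm hev) ?_
  refine Filter.Tendsto.mono_left ?_ nhdsWithin_le_nhds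
  -- Within `δ` of `x` the derivative has norm at most its norm at `x` plus `1`, which supplies the
  -- dominating function.
  obtain ⟨δ, hδ, hδb⟩ := Metric.continuousAt_iff.1 hcx 1 one_pos
  refine tendsto_integral_filter_of_dominated_convergence
    (fun ω => (‖iteratedFDeriv ℝ (k + 1) φ x‖ + 1) * ∏ q, ‖V ω q‖) ?_ ?_ ?_ ?_
  · filter_upwards [Metric.ball_mem_nhds x hr] with z hz
    have h1 : Continuous fun ω => iteratedFDeriv ℝ (k + 1) φ (R ω z) :=
      hcont.comp_continuous (hR.clm_apply continuous_const) fun ω => hRball r ω z hz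
    exact (ContinuousEval.continuous_eval.comp (h1.prodMk hV)).aestronglyMeasurable
  · filter_upwards [Metric.ball_mem_nhds x hδ] with z hz
    refine Filter.Eventually.of_forall fun ω => ?_
    refine (ContinuousMultilinearMap.le_opNorm _ _).trans ?_
    gcongr
    have h := hδb (Metric.mem_ball.1 (hRball δ ω z hz))
    rw [dist_eq_norm] at h
    have h2 := norm_le_norm_add_norm_sub' (iteratedFDeriv ℝ (k + 1) φ (R ω z))
      (iteratedFDeriv ℝ (k + 1) φ x)
    linarith
  · have : Continuous fun ω => (‖iteratedFDeriv ℝ (k + 1) φ x‖ + 1) * ∏ q, ‖V ω q‖ :=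
      continuous_const.mul (continuous_finsetProd _ fun q _ =>
        ((continuous_apply q).comp hV).norm)
    exact this.integrable_of_hasCompactSupport (HasCompactSupport.of_compactSpace _)
  · refine Filter.Eventually.of_forall fun ω => ?_
    have h1 : Filter.Tendsto (fun z => R ω z) (𝓝 x) (𝓝 x) := by
      have := (R ω).continuous.tendsto x
      rwa [hRx ω x hx] at this
    have h2 := hcx.tendsto.comp h1
    exact ((ContinuousMultilinearMap.apply ℝ (fun _ : Fin (k + 1) => (Fin N → ℝ)) ℝ
      (V ω)).continuous.tendsto _).comp h2

/-! ### Counting index tuples by the sizes of their fibres. -/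

/-- The number of bijections that carry one function to another one with equally large fibres. -/
theorem card_equiv_comp_eq {A B K : Type*} [Fintype A] [Fintype B] [DecidableEq A] [DecidableEq B]
    [DecidableEq K] (f : A → K) (f' : B → K)
    (h : ∀ c, (Finset.univ.filter fun a => f a = c).card =
      (Finset.univ.filter fun b => f' b = c).card) :
    (Finset.univ.filter fun E : A ≃ B => f' ∘ E = f).card =
      ∏ c ∈ Finset.univ.image f, (Finset.univ.filter fun a => f a = c).card.factorial := by
  have hcard : ∀ c, Fintype.card {a // f a = c} = Fintype.card {b // f' b = c} := fun c => by
    rw [Fintype.card_subtype, Fintype.card_subtype, h c]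
  -- Composition with one fixed matching bijection reduces the count to the stabilizer of `f`.
  let E₀ : A ≃ B := Equiv.ofFiberEquiv fun c => Fintype.equivOfCardEq (hcard c)
  have hE₀ : ∀ a, f' (E₀ a) = f a := fun a => Equiv.ofFiberEquiv_map _ a
  have hE₀' : ∀ b, f (E₀.symm b) = f' b := fun b => by rw [← hE₀, E₀.apply_symm_apply]
  have h1 := DomMulAct.stabilizer_card' f
  simp_rw [Fintype.card_subtype] at h1
  rw [← h1]
  refine Finset.card_bij' (fun E _ => E.trans E₀.symm) (fun g _ => g.trans E₀) ?_ ?_ ?_ ?_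
  · intro E hE
    simp only [Finset.mem_filter, Finset.mem_univ, true_and] at hE ⊢
    ext a
    exact (hE₀' (E a)).trans (congrFun hE a)
  · intro g hg
    simp only [Finset.mem_filter, Finset.mem_univ, true_and] at hg ⊢
    ext a
    have := congrFun hg a
    simpa [hE₀] using this
  · intro E _
    ext a
    simp
  · intro g _
    ext a
    simp

theorem exists_equiv_comp_eq {A B K : Type*} [Fintype A] [Fintype B] [DecidableEq K]
    (f : A → K) (f' : B → K)
    (h : ∀ c, (Finset.univ.filter fun a => f a = c).card =
      (Finset.univ.filter fun b => f' b = c).card) :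
    ∃ E : A ≃ B, ∀ a, f' (E a) = f a := by
  have hcard : ∀ c, Fintype.card {a // f a = c} = Fintype.card {b // f' b = c} := fun c => by
    rw [Fintype.card_subtype, Fintype.card_subtype, h c]
  exact ⟨Equiv.ofFiberEquiv fun c => Fintype.equivOfCardEq (hcard c),
    fun a => Equiv.ofFiberEquiv_map _ a⟩

/-- The number of preimages of `i`. -/
def fiberCard {A B : Type*} [Fintype A] [DecidableEq B] (f : A → B) (i : B) : ℕ :=
  (Finset.univ.filter fun q => f q = i).card

theorem fiberCard_pos {A B : Type*} [Fintype A] [DecidableEq B] {f : A → B} {i : B} :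
    0 < fiberCard f i ↔ ∃ q, f q = i := by
  simp [fiberCard, Finset.card_pos, Finset.filter_nonempty_iff]

theorem fiberCard_comp {A B K : Type*} [Fintype A] [DecidableEq B] [DecidableEq K] (f : A → B)
    {e : B → K} (he : Function.Injective e) (i : B) : fiberCard (e ∘ f) (e i) = fiberCard f i := by
  simp [fiberCard, he.eq_iff]

theorem fiberCard_comp_equiv {A B : Type*} [Fintype A] [DecidableEq B] (f : A → B)
    (π : Equiv.Perm A) (i : B) : fiberCard (f ∘ π) i = fiberCard f i :=
  Finset.card_equiv π (by simp)

theorem pattern_eq {N g : ℕ} (ι : Fin g → Fin N) :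
    pattern ι = (Finset.univ.image ι).val.map (fiberCard ι) := rfl

theorem count_pattern {N g : ℕ} (ι : Fin g → Fin N) (h : ℕ) :
    (pattern ι).count h =
      (Finset.univ.filter fun i : Finset.univ.image ι => fiberCard ι i = h).card := by
  rw [pattern_eq, Multiset.count_map, ← Finset.filter_val, Finset.card_val]
  refine Finset.card_bij' (fun i hi => ⟨i, (Finset.mem_filter.1 hi).1⟩) (fun i _ => i.1)
    ?_ ?_ ?_ ?_
  · intro i hi
    simpa [eq_comm] using (Finset.mem_filter.1 hi).2
  · intro i hi
    simp only [Finset.mem_filter, Finset.mem_univ, true_and] at hi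
    exact Finset.mem_filter.2 ⟨i.2, hi.symm⟩
  · intro i hi
    rfl
  · intro i hi
    rfl

/-- Injections `e` under which the fibres of `e ∘ κ` have the same cardinalities as those
of `ι`. -/
theorem card_matching_injections {N g l : ℕ} {κ : Fin g → Fin l} (hκ : Function.Surjective κ)
    (ι : Fin g → Fin N) (hpat : pattern ι = Finset.univ.val.map (fiberCard κ)) :
    (Finset.univ.filter fun e : Fin l → Fin N => Function.Injective e ∧
      ∀ j, fiberCard (e ∘ κ) j = fiberCard ι j).card =
      ∏ h ∈ Finset.univ.image (fiberCard κ), ((pattern ι).count h).factorial := by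
  have hcount : ∀ h, (pattern ι).count h =
      (Finset.univ.filter fun i => fiberCard κ i = h).card := fun h => by
    rw [hpat, Multiset.count_map, ← Finset.filter_val, Finset.card_val]
    simp_rw [eq_comm]
  have h1 := card_equiv_comp_eq (fiberCard κ) (fun i : Finset.univ.image ι => fiberCard ι i)
    (fun h => by rw [← hcount, count_pattern])
  simp_rw [hcount]
  rw [← h1]
  symm
  refine Finset.card_bij (fun E _ => fun i => (E i : Fin N)) ?_ ?_ ?_
  · intro E hE
    simp only [Finset.mem_filter, Finset.mem_univ, true_and] at hE ⊢
    have hinj : Function.Injective fun i => (E i : Fin N) :=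
      Subtype.val_injective.comp E.injective
    refine ⟨hinj, fun j => ?_⟩
    by_cases hj : j ∈ Finset.univ.image ι
    · obtain ⟨i, hi⟩ := E.surjective ⟨j, hj⟩
      have hi' : j = (fun i => (E i : Fin N)) i := by simp [hi]
      rw [hi', fiberCard_comp κ hinj, ← congrFun hE i]
      rfl
    · have e1 : ¬ 0 < fiberCard ι j := by
        rw [fiberCard_pos]
        rintro ⟨q, hq⟩
        exact hj (by simp [← hq])
      have e2 : ¬ 0 < fiberCard ((fun i => (E i : Fin N)) ∘ κ) j := by
        rw [fiberCard_pos]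
        rintro ⟨q, hq⟩
        exact hj (hq ▸ (E (κ q)).2)
      omega
  · intro E _ E' _ h
    ext i
    exact congrArg Fin.val (congrFun h i)
  · intro e he
    simp only [Finset.mem_filter, Finset.mem_univ, true_and] at he
    obtain ⟨hinj, he⟩ := he
    have hmem : ∀ i, e i ∈ Finset.univ.image ι := by
      intro i
      obtain ⟨q, hq⟩ := hκ i
      have : 0 < fiberCard ι (e i) := by
        rw [← he, fiberCard_pos]
        exact ⟨q, by simp [hq]⟩
      obtain ⟨q', hq'⟩ := fiberCard_pos.1 this
      simp [← hq']
    have hbij : Function.Bijective fun i => (⟨e i, hmem i⟩ : Finset.univ.image ι) := by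
      constructor
      · intro i i' h
        exact hinj (congrArg Subtype.val h)
      · rintro ⟨j, hj⟩
        obtain ⟨q, -, hq⟩ := Finset.mem_image.1 hj
        have : 0 < fiberCard (e ∘ κ) j := by
          rw [he, fiberCard_pos]
          exact ⟨q, hq⟩
        obtain ⟨q', hq'⟩ := fiberCard_pos.1 this
        exact ⟨κ q', Subtype.ext hq'⟩
    refine ⟨Equiv.ofBijective _ hbij, ?_, rfl⟩
    simp only [Finset.mem_filter, Finset.mem_univ, true_and]
    ext i
    simp [← he, fiberCard_comp κ hinj]

theorem card_perm_comp_eq {N g l : ℕ} {κ : Fin g → Fin l} (hκ : Function.Surjective κ)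
    (ι : Fin g → Fin N) {e : Fin l → Fin N} (he : Function.Injective e)
    (h : ∀ j, fiberCard (e ∘ κ) j = fiberCard ι j) :
    (Finset.univ.filter fun π : Equiv.Perm (Fin g) => ι ∘ π = e ∘ κ).card =
      ∏ i, (fiberCard κ i).factorial := by
  rw [card_equiv_comp_eq (e ∘ κ) ι h, ← Finset.image_image, Finset.image_univ_of_surjective hκ,
    Finset.prod_image fun _ _ _ _ h => he h]
  exact Finset.prod_congr rfl fun i _ => congrArg Nat.factorial (fiberCard_comp κ he i)

theorem pattern_eq_of_comp_eq {N g l : ℕ} {κ : Fin g → Fin l} (hκ : Function.Surjective κ)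
    (ι : Fin g → Fin N) {e : Fin l → Fin N} (he : Function.Injective e)
    (h : ∀ j, fiberCard (e ∘ κ) j = fiberCard ι j) :
    pattern ι = Finset.univ.val.map (fiberCard κ) := by
  have himage : Finset.univ.image ι = Finset.univ.map ⟨e, he⟩ := by
    ext j
    have h1 : j ∈ Finset.univ.image ι ↔ 0 < fiberCard ι j := by simp [fiberCard_pos]
    rw [h1, ← h, fiberCard_pos]
    simp only [Function.comp_apply, Finset.mem_map, Finset.mem_univ, true_and,
      Function.Embedding.coeFn_mk]
    exact ⟨fun ⟨q, hq⟩ => ⟨κ q, hq⟩, fun ⟨i, hi⟩ => (hκ i).imp fun q hq => by rw [hq, hi]⟩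
  rw [pattern_eq, himage, Finset.map_val, Multiset.map_map]
  refine Multiset.map_congr rfl fun i _ => ?_
  simp [← h, fiberCard_comp κ he]

/-- Counting the pairs of an injection `e` and a permutation `π` with `e ∘ κ = ι ∘ π`. -/
theorem card_pairs {N g l : ℕ} {κ : Fin g → Fin l} (hκ : Function.Surjective κ)
    (ι : Fin g → Fin N) :
    ∑ e : Fin l → Fin N with Function.Injective e,
      (Finset.univ.filter fun π : Equiv.Perm (Fin g) => ι ∘ π = e ∘ κ).card =
    if pattern ι = Finset.univ.val.map (fiberCard κ) then
      (∏ i, (fiberCard κ i).factorial) *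
        ∏ h ∈ Finset.univ.image (fiberCard κ), ((pattern ι).count h).factorial
    else 0 := by
  have hzero : ∀ e : Fin l → Fin N, ¬ (∀ j, fiberCard (e ∘ κ) j = fiberCard ι j) →
      (Finset.univ.filter fun π : Equiv.Perm (Fin g) => ι ∘ π = e ∘ κ).card = 0 := by
    intro e hne
    rw [Finset.card_eq_zero, Finset.filter_eq_empty_iff]
    intro π _ hπ
    exact hne fun j => by rw [← hπ, fiberCard_comp_equiv]
  split_ifs with hpat
  · rw [← card_matching_injections hκ ι hpat, mul_comm, ← smul_eq_mul, ← Finset.sum_const,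
      ← Finset.filter_filter, Finset.sum_filter (fun e : Fin l → Fin N =>
        ∀ j, fiberCard (e ∘ κ) j = fiberCard ι j)]
    refine Finset.sum_congr rfl fun e he => ?_
    split_ifs with h
    · exact card_perm_comp_eq hκ ι (Finset.mem_filter.1 he).2 h
    · exact hzero e h
  · refine Finset.sum_eq_zero fun e he => hzero e fun h => hpat ?_
    exact pattern_eq_of_comp_eq hκ ι (Finset.mem_filter.1 he).2 h

/-! ### Augmented monomials as test functions. -/

/-- The factor kills the term of the node `b` and cancels its factor in all other denominators. -/
theorem dividedDiff_mul_sub {N : ℕ} {I : Finset (Fin N)} {b : Fin N} (hb : b ∉ I)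
    (F : Fin N → ℝ) {z : Fin N → ℝ} (hz : Function.Injective z) :
    dividedDiff (insert b I) (fun i => F i * (z b - z i)) z = dividedDiff I F z := by
  rw [dividedDiff_insert hb, sub_self, mul_zero, zero_div, zero_add, dividedDiff]
  refine Finset.sum_congr rfl fun i hi => ?_
  have : z b - z i ≠ 0 := sub_ne_zero.2 fun h => hb (hz h ▸ hi)
  rw [mul_comm (F i), mul_div_mul_left _ _ this]

theorem dividedDiff_sub {N : ℕ} (I : Finset (Fin N)) (F G z : Fin N → ℝ) :
    dividedDiff I (fun i => F i - G i) z = dividedDiff I F z - dividedDiff I G z := by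
  simp [dividedDiff, sub_div, Finset.sum_sub_distrib]

theorem dividedDiff_const_mul {N : ℕ} (I : Finset (Fin N)) (a : ℝ) (F z : Fin N → ℝ) :
    dividedDiff I (fun i => a * F i) z = a * dividedDiff I F z := by
  simp [dividedDiff, Finset.mul_sum, mul_div_assoc]

theorem dividedDiff_add {N : ℕ} (I : Finset (Fin N)) (F G z : Fin N → ℝ) :
    dividedDiff I (fun i => F i + G i) z = dividedDiff I F z + dividedDiff I G z := by
  simp [dividedDiff, add_div, Finset.sum_add_distrib]

theorem dividedDiff_sum {N : ℕ} {T : Type*} (s : Finset T) (I : Finset (Fin N))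
    (F : T → Fin N → ℝ) (z : Fin N → ℝ) :
    dividedDiff I (fun i => ∑ t ∈ s, F t i) z = ∑ t ∈ s, dividedDiff I (F t) z := by
  simp only [dividedDiff, Finset.sum_div]
  exact Finset.sum_comm

/-- Divided differences of the monomials of degree less than the number of nodes. -/
theorem dividedDiff_pow {N : ℕ} {z : Fin N → ℝ} (hz : Function.Injective z) (n : ℕ) :
    ∀ I : Finset (Fin N), I.card = n + 1 → ∀ m ≤ n,
      dividedDiff I (fun i => z i ^ m) z = if m = n then (-1) ^ n else 0 := by
  induction n with
  | zero =>
    intro I hI m hm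
    obtain ⟨a, rfl⟩ := Finset.card_eq_one.1 hI
    obtain rfl : m = 0 := by omega
    simp [dividedDiff]
  | succ n ih =>
    intro I hI m hm
    obtain ⟨b, T, hbT, rfl, hT⟩ := Finset.card_eq_succ.1 hI
    obtain ⟨a, S, haS, rfl, hS⟩ := Finset.card_eq_succ.1 hT
    have hab : a ≠ b := fun h => hbT (h ▸ Finset.mem_insert_self a S)
    have hbS : b ∉ S := fun h => hbT (Finset.mem_insert_of_mem h)
    -- In these degrees the two shorter divided differences agree by induction, so the recurrence
    -- gives zero.
    have hlow : ∀ m ≤ n, dividedDiff (insert b (insert a S)) (fun i => z i ^ m) z = 0 := by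
      intro m hm
      have h := sub_mul_dividedDiff hab haS hbS (fun i => z i ^ m) hz
      rw [ih _ hT m hm, ih (insert b S) (by rw [Finset.card_insert_of_notMem hbS, hS]) m hm,
        sub_self, Finset.insert_comm] at h
      exact (mul_eq_zero.1 h).resolve_left (sub_ne_zero.2 fun h => hab (hz h).symm)
    split_ifs with h
    · subst h
      -- The top degree comes from multiplying degree `n` by `z b - z i`.
      have h1 := dividedDiff_mul_sub hbT (fun i => z i ^ n) hz
      have h2 : (fun i => z i ^ n * (z b - z i)) = fun i => z b * z i ^ n - z i ^ (n + 1) := by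
        ext i
        ring
      rw [h2, dividedDiff_sub, dividedDiff_const_mul, hlow n le_rfl, ih _ hT n le_rfl,
        if_pos rfl] at h1
      rw [pow_succ]
      linarith
    · exact hlow m (by omega)

theorem DI_mul {N : ℕ} (I : Finset (Fin N)) {f h : (Fin N → ℝ) → ℝ} {z : Fin N → ℝ}
    (hf : DifferentiableAt ℝ f z) (hh : DifferentiableAt ℝ h z) :
    DI I (fun t => f t * h t) z = f z * DI I h z + h z * DI I f z := by
  simp only [DI_eq_dividedDiff]
  rw [← dividedDiff_const_mul, ← dividedDiff_const_mul, ← dividedDiff_add]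
  congr 1
  ext i
  unfold partialDeriv
  rw [fderiv_fun_mul hf hh]
  simp

theorem DI_sub {N : ℕ} (I : Finset (Fin N)) {f h : (Fin N → ℝ) → ℝ} {z : Fin N → ℝ}
    (hf : DifferentiableAt ℝ f z) (hh : DifferentiableAt ℝ h z) :
    DI I (fun t => f t - h t) z = DI I f z - DI I h z := by
  simp only [DI_eq_dividedDiff]
  rw [← dividedDiff_sub]
  congr 1
  ext i
  unfold partialDeriv
  rw [fderiv_fun_sub hf hh]
  simp

theorem DI_sum {N : ℕ} {T : Type*} (s : Finset T) (I : Finset (Fin N))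
    {f : T → (Fin N → ℝ) → ℝ} {z : Fin N → ℝ} (hf : ∀ t ∈ s, DifferentiableAt ℝ (f t) z) :
    DI I (fun y => ∑ t ∈ s, f t y) z = ∑ t ∈ s, DI I (f t) z := by
  simp only [DI_eq_dividedDiff]
  rw [← dividedDiff_sum]
  congr 1
  ext i
  unfold partialDeriv
  rw [fderiv_fun_sum hf]
  simp

/-- The augmented monomial symmetric function: the sum of the monomials `∏ i, t (e i) ^ n i` over
all injections `e`. -/
noncomputable def augMonomial {N l : ℕ} (n : Fin l → ℕ) (t : Fin N → ℝ) : ℝ :=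
  ∑ e : Fin l → Fin N with Function.Injective e, ∏ i, t (e i) ^ n i

theorem augMonomial_symmetric {N l : ℕ} (n : Fin l → ℕ) :
    IsSymmetric (augMonomial n : (Fin N → ℝ) → ℝ) := by
  intro π t
  unfold augMonomial
  refine Finset.sum_equiv (Equiv.arrowCongr (Equiv.refl _) π) ?_ ?_
  · intro e
    simp [Equiv.arrowCongr]
  · intro e _
    simp [Equiv.arrowCongr]

theorem contDiff_augMonomial {N l : ℕ} (n : Fin l → ℕ) {m : WithTop ℕ∞} :
    ContDiff ℝ m (augMonomial n : (Fin N → ℝ) → ℝ) := by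
  unfold augMonomial
  fun_prop

theorem augMonomial_zero {N l : ℕ} {n : Fin (l + 1) → ℕ} (hn : ∀ i, 0 < n i) :
    augMonomial n (0 : Fin N → ℝ) = 0 := by
  unfold augMonomial
  refine Finset.sum_eq_zero fun e _ => ?_
  exact Finset.prod_eq_zero (Finset.mem_univ 0) (by simp [(hn 0).ne'])

theorem augMonomial_one {N : ℕ} (n : Fin 1 → ℕ) :
    (augMonomial n : (Fin N → ℝ) → ℝ) = fun t => ∑ j, t j ^ n 0 := by
  ext t
  unfold augMonomial
  rw [Finset.filter_true_of_mem fun e _ => Function.injective_of_subsingleton e]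
  exact Fintype.sum_equiv (Equiv.funUnique (Fin 1) (Fin N)) _ _ fun e => by simp

/-- In the product with a power sum, the extra index either avoids all values of `e` or equals
exactly one `e i`; in the second case the exponents merge. -/
theorem augMonomial_cons {N l : ℕ} (m : ℕ) (n : Fin l → ℕ) (t : Fin N → ℝ) :
    augMonomial (Fin.cons m n : Fin (l + 1) → ℕ) t = (∑ j, t j ^ m) * augMonomial n t -
      ∑ i, augMonomial (Function.update n i (n i + m)) t := by
  have hL : augMonomial (Fin.cons m n : Fin (l + 1) → ℕ) t =
      ∑ e : Fin l → Fin N with Function.Injective e,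
        ∑ j with j ∉ Set.range e, t j ^ m * ∏ i, t (e i) ^ n i := by
    unfold augMonomial
    simp_rw [Finset.sum_filter]
    rw [← (Fin.consEquiv fun _ => Fin N).sum_comp, Fintype.sum_prod_type, Finset.sum_comm]
    refine Finset.sum_congr rfl fun e _ => ?_
    split_ifs with he
    · refine Finset.sum_congr rfl fun j _ => ?_
      simp [Fin.consEquiv, Fin.cons_injective_iff, he, Fin.prod_univ_succ]
    · simp [Fin.consEquiv, Fin.cons_injective_iff, he]
  have hR : ∑ i, augMonomial (Function.update n i (n i + m)) t =
      ∑ e : Fin l → Fin N with Function.Injective e,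
        ∑ j with j ∈ Set.range e, t j ^ m * ∏ i, t (e i) ^ n i := by
    unfold augMonomial
    rw [Finset.sum_comm]
    refine Finset.sum_congr rfl fun e he => ?_
    have he' := (Finset.mem_filter.1 he).2
    have himage : (Finset.univ.filter fun j => j ∈ Set.range e) = Finset.univ.image e := by
      ext j
      simp
    rw [himage, Finset.sum_image fun _ _ _ _ h => he' h]
    refine Finset.sum_congr rfl fun i _ => ?_
    rw [← Finset.mul_prod_erase _ _ (Finset.mem_univ i),
      ← Finset.mul_prod_erase Finset.univ (fun i => t (e i) ^ n i) (Finset.mem_univ i),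
      Function.update_self, pow_add, mul_comm (t (e i) ^ n i), mul_assoc]
    congr 2
    refine Finset.prod_congr rfl fun q hq => ?_
    rw [Function.update_of_ne (Finset.ne_of_mem_erase hq)]
  rw [hL, hR, eq_sub_iff_add_eq, ← Finset.sum_add_distrib]
  unfold augMonomial
  rw [Finset.mul_sum]
  refine Finset.sum_congr rfl fun e _ => ?_
  rw [Finset.sum_mul, add_comm]
  exact Finset.sum_filter_add_sum_filter_not _ _ _

theorem DI_powerSum {N k : ℕ} {J : Finset (Fin N)} (hJ : J.card = k + 1) {z : Fin N → ℝ}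
    (hz : Function.Injective z) :
    DI J (fun t => ∑ j, t j ^ (k + 1)) z = (-1) ^ k * (k + 1) := by
  have h : ∀ i, partialDeriv i (fun t : Fin N → ℝ => ∑ j, t j ^ (k + 1)) z =
      (k + 1 : ℝ) * z i ^ k := by
    intro i
    unfold partialDeriv
    have h1 : HasFDerivAt (fun t : Fin N → ℝ => ∑ j, t j ^ (k + 1)) _ z :=
      HasFDerivAt.fun_sum fun j _ => (hasFDerivAt_apply (𝕜 := ℝ) j z).pow (k + 1)
    rw [h1.fderiv]
    simp [Pi.single_apply]
  rw [DI_eq_dividedDiff]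
  simp_rw [h]
  rw [dividedDiff_const_mul, dividedDiff_pow hz k J hJ k le_rfl, if_pos rfl, mul_comm]

/-- The points with coordinates `i / (n + 1)` are injective and tend to the origin. This makes
limits there unique, so that coefficients can be compared. -/
instance neBot_injective {N : ℕ} :
    (𝓝[{z : Fin N → ℝ | Function.Injective z}] (0 : Fin N → ℝ)).NeBot := by
  rw [← mem_closure_iff_nhdsWithin_neBot, mem_closure_iff_seq_limit]
  refine ⟨fun n i => (1 / ((n : ℝ) + 1)) * (i : ℕ), fun n i j h => ?_, ?_⟩
  · have hn : (1 / ((n : ℝ) + 1)) ≠ 0 := by positivity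
    exact Fin.ext (by exact_mod_cast mul_left_cancel₀ hn h)
  · rw [tendsto_pi_nhds]
    intro i
    simpa using (tendsto_one_div_add_atTop_nhds_zero_nat (𝕜 := ℝ)).mul_const ((i : ℕ) : ℝ)

/-- Induction on the number of factors through `augMonomial_cons`. The two Leibniz terms vanish in
the limit, since each is a function tending to `0` times a convergent `DI`. What remains is minus `l
+ 1` merged monomials of the same total degree, whence the sign and the factorial. -/
theorem tendsto_DI_augMonomial {N k : ℕ} {J : Finset (Fin N)} (hJ : J.card = k + 1) (l : ℕ) :
    ∀ n : Fin (l + 1) → ℕ, (∀ i, 0 < n i) → ∑ i, n i = k + 1 →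
      Filter.Tendsto (fun z => DI J (augMonomial n) z)
        (𝓝[{z | Function.Injective z}] 0)
        (𝓝 ((-1) ^ k * (-1) ^ l * (k + 1) * (l.factorial : ℝ))) := by
  obtain ⟨c, -, hc⟩ := exists_tendsto_DI J hJ
  have hdiff : ∀ {l : ℕ} (n : Fin l → ℕ) (z : Fin N → ℝ),
      DifferentiableAt ℝ (augMonomial n) z := fun n z =>
    ((contDiff_augMonomial n (m := 1)).differentiable (by norm_num)) z
  have hlim : ∀ {l : ℕ} (n : Fin l → ℕ), ∃ L, Filter.Tendsto (fun z => DI J (augMonomial n) z)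
      (𝓝[{z | Function.Injective z}] 0) (𝓝 L) := fun n =>
    ⟨_, hc _ (augMonomial_symmetric n) 0 (by simp) (contDiff_augMonomial n).contDiffAt⟩
  have hzero : ∀ {l : ℕ} (n : Fin (l + 1) → ℕ), (∀ i, 0 < n i) →
      Filter.Tendsto (fun z : Fin N → ℝ => augMonomial n z)
      (𝓝[{z | Function.Injective z}] 0) (𝓝 0) := by
    intro l n hn
    have h := (contDiff_augMonomial n (N := N) (m := 0)).continuous.tendsto 0
    rw [augMonomial_zero hn] at h
    exact h.mono_left nhdsWithin_le_nhds
  induction l with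
  | zero =>
    intro n _ hsum
    rw [Fin.sum_univ_one] at hsum
    rw [augMonomial_one, hsum]
    refine Filter.Tendsto.congr' (f₁ := fun _ => (-1) ^ k * (k + 1 : ℝ)) ?_ (by simp)
    filter_upwards [self_mem_nhdsWithin] with z hz
    exact (DI_powerSum hJ hz).symm
  | succ l ih =>
    intro n hn hsum
    obtain ⟨m, n, rfl⟩ : ∃ m n', n = (Fin.cons m n' : Fin (l + 2) → ℕ) :=
      ⟨n 0, Fin.tail n, (Fin.cons_self_tail n).symm⟩
    have hm : 0 < m := by simpa using hn 0
    have hn' : ∀ i, 0 < n i := fun i => by simpa using hn i.succ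
    rw [Fin.sum_univ_succ] at hsum
    simp only [Fin.cons_zero, Fin.cons_succ] at hsum
    have hfun : (augMonomial (Fin.cons m n : Fin (l + 2) → ℕ) : (Fin N → ℝ) → ℝ) =
        fun t => augMonomial (fun _ : Fin 1 => m) t * augMonomial n t -
          ∑ i, augMonomial (Function.update n i (n i + m)) t := by
      ext t
      rw [augMonomial_cons, augMonomial_one]
    have hDI : ∀ z, DI J (augMonomial (Fin.cons m n : Fin (l + 2) → ℕ)) z =
        (augMonomial (fun _ : Fin 1 => m) z * DI J (augMonomial n) z +
          augMonomial n z * DI J (augMonomial (fun _ : Fin 1 => m)) z) -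
          ∑ i, DI J (augMonomial (Function.update n i (n i + m))) z := by
      intro z
      rw [hfun, DI_sub _ ((hdiff _ z).fun_mul (hdiff _ z))
        (DifferentiableAt.fun_sum fun i _ => hdiff _ z), DI_mul _ (hdiff _ z) (hdiff _ z),
        DI_sum _ _ fun i _ => hdiff _ z]
    simp_rw [hDI]
    obtain ⟨L₁, h₁⟩ := hlim n
    obtain ⟨L₂, h₂⟩ := hlim (fun _ : Fin 1 => m)
    have h₃ : Filter.Tendsto
        (fun z => ∑ i, DI J (augMonomial (Function.update n i (n i + m))) z)
        (𝓝[{z | Function.Injective z}] 0)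
        (𝓝 (∑ _i : Fin (l + 1), (-1) ^ k * (-1) ^ l * (k + 1) * (l.factorial : ℝ))) := by
      refine tendsto_finsetSum _ fun i _ => ih _ (fun q => ?_) ?_
      · by_cases hq : q = i
        · subst hq
          simp [hm]
        · simp [hq, hn']
      · rw [Finset.sum_update_of_mem (Finset.mem_univ i), ← hsum,
          ← Finset.add_sum_erase _ _ (Finset.mem_univ i), Finset.sdiff_singleton_eq_erase]
        ring
    convert (((hzero (fun _ : Fin 1 => m) fun _ => hm).mul h₁).add
      ((hzero n hn').mul h₂)).sub h₃ using 2
    rw [Finset.sum_const, Finset.card_univ, Fintype.card_fin, Nat.factorial_succ]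
    push_cast
    rw [nsmul_eq_mul]
    push_cast
    ring

/-! ### Identification of the one-block limit with `blockDeriv`. -/

/-- The monomial `∏ q, t (κ q)`, as the diagonal of a multilinear map. -/
noncomputable def monomialForm {N g : ℕ} (κ : Fin g → Fin N) :
    ContinuousMultilinearMap ℝ (fun _ : Fin g => (Fin N → ℝ)) ℝ :=
  (ContinuousMultilinearMap.mkPiAlgebra ℝ (Fin g) ℝ).compContinuousLinearMap
    fun q => ContinuousLinearMap.proj (κ q)

theorem monomialForm_apply {N g : ℕ} (κ : Fin g → Fin N) (v : Fin g → Fin N → ℝ) :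
    monomialForm κ v = ∏ q, v q (κ q) := by
  simp [monomialForm]

/-- Each monomial is the diagonal of a `g`-linear form, whose derivative of order `g` is the sum of
the form over all orderings of the arguments; on basis vectors every summand is `0` or `1`. -/
theorem mixedDeriv_augMonomial {N g l : ℕ} (κ : Fin g → Fin l) (ι : Fin g → Fin N)
    (x : Fin N → ℝ) :
    mixedDeriv ι (augMonomial (fiberCard κ)) x =
      ((∑ e : Fin l → Fin N with Function.Injective e,
        (Finset.univ.filter fun π : Equiv.Perm (Fin g) => ι ∘ π = e ∘ κ).card : ℕ) : ℝ) := by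
  have hfun : (augMonomial (fiberCard κ) : (Fin N → ℝ) → ℝ) =
      fun t => ∑ e : Fin l → Fin N with Function.Injective e,
        monomialForm (e ∘ κ) (fun _ => t) := by
    ext t
    unfold augMonomial
    refine Finset.sum_congr rfl fun e _ => ?_
    rw [monomialForm_apply]
    simp only [Function.comp_apply]
    rw [← Finset.prod_fiberwise Finset.univ κ fun q => t (e (κ q))]
    refine Finset.prod_congr rfl fun i _ => ?_
    rw [Finset.prod_congr rfl (g := fun _ => t (e i))
      (fun q hq => by rw [(Finset.mem_filter.1 hq).2]), Finset.prod_const]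
    rfl
  unfold mixedDeriv
  rw [hfun, iteratedFDeriv_fun_sum_apply]
  · rw [sum_apply]
    push_cast
    refine Finset.sum_congr rfl fun e _ => ?_
    rw [ContinuousMultilinearMap.iteratedFDeriv_comp_diagonal, Finset.card_filter]
    push_cast
    refine Finset.sum_congr rfl fun π _ => ?_
    rw [monomialForm_apply]
    simp_rw [Pi.single_apply]
    rw [Finset.prod_boole]
    simp only [Finset.mem_univ, true_implies, funext_iff, Function.comp_apply]
    congr 1
    simp_rw [eq_comm]
  · intro e _
    have : ContDiff ℝ g fun t : Fin N → ℝ => monomialForm (e ∘ κ) fun _ => t :=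
      (monomialForm (e ∘ κ)).contDiff.comp (by fun_prop)
    exact this.contDiffAt

/-- The partition formed by the multiplicities of the values of `ι`. -/
def patternPartition {N g : ℕ} (ι : Fin g → Fin N) : g.Partition where
  parts := pattern ι
  parts_pos := by
    intro h hh
    rw [pattern_eq] at hh
    obtain ⟨i, hi, rfl⟩ := Multiset.mem_map.1 hh
    obtain ⟨q, hq⟩ : ∃ q, ι q = i := by simpa using hi
    exact fiberCard_pos.2 ⟨q, hq⟩
  parts_sum := by
    rw [pattern_eq]
    change ∑ i ∈ Finset.univ.image ι, fiberCard ι i = g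
    unfold fiberCard
    rw [← Finset.card_eq_sum_card_image, Finset.card_univ, Fintype.card_fin]

theorem mem_assignments {N g : ℕ} {J : Finset (Fin N)} {σ : g.Partition} {ι : Fin g → Fin N} :
    ι ∈ assignments J σ ↔ (∀ q, ι q ∈ J) ∧ patternPartition ι = σ := by
  simp [assignments, Nat.Partition.ext_iff, patternPartition]

theorem partitionCoeff_eq {k l : ℕ} (σ : (k + 1).Partition) (hl : σ.parts.card = l + 1) :
    partitionCoeff σ * ∏ h ∈ Finset.Icc 1 (k + 1),
      ((h.factorial : ℝ) ^ σ.parts.count h * ((σ.parts.count h).factorial : ℝ)) =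
      (-1) ^ k * (-1) ^ l * (k + 1) * (l.factorial : ℝ) := by
  have hne : ∏ h ∈ Finset.Icc 1 (k + 1),
      ((h.factorial : ℝ) ^ σ.parts.count h * ((σ.parts.count h).factorial : ℝ)) ≠ 0 := by
    positivity
  have hlk : l + 1 ≤ k + 1 := by
    rw [← hl]
    -- Parts are at least `1`, so there are at most `k + 1` of them and the truncated subtraction in
    -- the sign is a true one.
    conv_rhs => rw [← σ.parts_sum]
    simpa using Multiset.card_nsmul_le_sum (s := σ.parts) (a := 1) fun h hh => σ.parts_pos hh
  unfold partitionCoeff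
  rw [div_mul_cancel₀ _ hne, hl]
  have hsign : (-1 : ℝ) ^ (k + 1 - (l + 1)) = (-1) ^ k * (-1) ^ l := by
    obtain ⟨j, rfl⟩ := Nat.exists_eq_add_of_le (Nat.le_of_succ_le_succ hlk)
    have h1 : l + j + 1 - (l + 1) = j := by omega
    have h2 : (-1 : ℝ) ^ l * (-1) ^ l = 1 := by rw [← mul_pow]; simp
    rw [h1, pow_add]
    linear_combination (-(-1 : ℝ) ^ j) * h2
  rw [hsign]
  push_cast
  ring

/-- Enumerating the values of a function on `Fin (k + 1)`. -/
theorem exists_surjective_factorization {N k : ℕ} (ι : Fin (k + 1) → Fin N) :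
    ∃ (l : ℕ) (κ : Fin (k + 1) → Fin (l + 1)), Function.Surjective κ ∧
      pattern ι = Finset.univ.val.map (fiberCard κ) := by
  obtain ⟨l, hl⟩ : ∃ l, (Finset.univ.image ι).card = l + 1 :=
    Nat.exists_eq_succ_of_ne_zero (Finset.card_ne_zero_of_mem
      (Finset.mem_image_of_mem ι (Finset.mem_univ 0)))
  let E := (Finset.univ.image ι).equivFinOfCardEq hl
  let κ : Fin (k + 1) → Fin (l + 1) := fun q =>
    E ⟨ι q, Finset.mem_image_of_mem ι (Finset.mem_univ q)⟩
  have hκ : Function.Surjective κ := by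
    intro i
    obtain ⟨q, -, hq⟩ := Finset.mem_image.1 (E.symm i).2
    refine ⟨q, ?_⟩
    simp only [κ]
    rw [← E.eq_symm_apply]
    exact Subtype.ext hq
  refine ⟨l, κ, hκ, pattern_eq_of_comp_eq hκ ι (e := fun i => E.symm i)
    (Subtype.val_injective.comp E.symm.injective) fun j => ?_⟩
  congr 1
  ext q
  simp [κ]

theorem prod_factorial_eq {k l : ℕ} {κ : Fin (k + 1) → Fin (l + 1)} (hκ : Function.Surjective κ)
    (σ : (k + 1).Partition) (hσ : σ.parts = Finset.univ.val.map (fiberCard κ)) :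
    (((∏ i, (fiberCard κ i).factorial) *
      ∏ h ∈ Finset.univ.image (fiberCard κ), (σ.parts.count h).factorial : ℕ) : ℝ) =
    ∏ h ∈ Finset.Icc 1 (k + 1),
      ((h.factorial : ℝ) ^ σ.parts.count h * ((σ.parts.count h).factorial : ℝ)) := by
  have hcount : ∀ h, σ.parts.count h =
      (Finset.univ.filter fun i => fiberCard κ i = h).card := fun h => by
    rw [hσ, Multiset.count_map, ← Finset.filter_val, Finset.card_val]
    simp_rw [eq_comm]
  have hsub : Finset.univ.image (fiberCard κ) ⊆ Finset.Icc 1 (k + 1) := by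
    intro h hh
    obtain ⟨i, -, rfl⟩ := Finset.mem_image.1 hh
    rw [Finset.mem_Icc]
    refine ⟨fiberCard_pos.2 (hκ i), ?_⟩
    unfold fiberCard
    exact (Finset.card_le_univ _).trans (by simp)
  rw [Finset.prod_mul_distrib]
  push_cast
  congr 1
  · rw [← Finset.prod_fiberwise_of_maps_to (s := Finset.univ) (t := Finset.Icc 1 (k + 1))
      (g := fiberCard κ) (fun i _ => hsub (Finset.mem_image_of_mem _ (Finset.mem_univ i)))]
    refine Finset.prod_congr rfl fun h _ => ?_
    rw [hcount, Finset.prod_congr rfl (g := fun _ => (h.factorial : ℝ))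
      (fun i hi => by rw [(Finset.mem_filter.1 hi).2]), Finset.prod_const]
  · refine Finset.prod_subset hsub fun h _ hh => ?_
    rw [hcount, Finset.card_eq_zero.2, Nat.factorial_zero, Nat.cast_one]
    rw [Finset.filter_eq_empty_iff]
    intro i _ hi
    exact hh (hi ▸ Finset.mem_image_of_mem _ (Finset.mem_univ i))

/-- The coefficients in the limit of `D_J φ` add up to `partitionCoeff σ` over the assignments
of `σ`. -/
theorem sum_assignments_eq_partitionCoeff {N k : ℕ} {J H : Finset (Fin N)} (hJ : J.card = k + 1)
    (hJH : J ⊆ H) {c : (Fin (k + 1) → Fin N) → ℝ} (hc0 : ∀ ι, (∃ q, ι q ∉ J) → c ι = 0)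
    (hc : ∀ φ : (Fin N → ℝ) → ℝ, IsSymmetric φ → ContDiffAt ℝ ((k + 1 : ℕ) : WithTop ℕ∞) φ 0 →
        Filter.Tendsto (fun z => DI J φ z) (𝓝[{z | Function.Injective z}] 0)
          (𝓝 (∑ ι, c ι * mixedDeriv ι φ 0)))
    (σ : (k + 1).Partition) (hσ : (assignments H σ).Nonempty) :
    ∑ ι ∈ assignments H σ, c ι = partitionCoeff σ := by
  obtain ⟨ι₀, hι₀⟩ := hσ
  rw [mem_assignments] at hι₀
  obtain ⟨l, κ, hκ, hpat⟩ := exists_surjective_factorization ι₀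
  have hσκ : σ.parts = Finset.univ.val.map (fiberCard κ) := by
    rw [← hpat, ← hι₀.2]
    rfl
  have hl : σ.parts.card = l + 1 := by
    rw [hσκ]
    simp
  have hsum : ∑ i, fiberCard κ i = k + 1 := by
    have := σ.parts_sum
    rw [hσκ] at this
    exact this
  -- The augmented monomial with exponents `σ` is the test function: its derivative along `ι` is `0`
  -- unless `ι` has pattern `σ`, and then it is the constant `K` below.
  have hlim := tendsto_nhds_unique
    (hc _ (augMonomial_symmetric (fiberCard κ)) (contDiff_augMonomial _).contDiffAt)
    (tendsto_DI_augMonomial hJ l (fiberCard κ) (fun i => fiberCard_pos.2 (hκ i)) hsum)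
  rw [← partitionCoeff_eq σ hl, ← prod_factorial_eq hκ σ hσκ] at hlim
  simp_rw [mixedDeriv_augMonomial, card_pairs hκ, ← hσκ] at hlim
  set K : ℕ := (∏ i, (fiberCard κ i).factorial) *
      ∏ h ∈ Finset.univ.image (fiberCard κ), (σ.parts.count h).factorial with hK
  have hK0 : (K : ℝ) ≠ 0 := by
    have : K ≠ 0 := by
      rw [hK]
      exact mul_ne_zero (Finset.prod_ne_zero_iff.2 fun _ _ => Nat.factorial_ne_zero _)
        (Finset.prod_ne_zero_iff.2 fun _ _ => Nat.factorial_ne_zero _)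
    exact_mod_cast this
  apply mul_right_cancel₀ hK0
  rw [← hlim, Finset.sum_mul]
  refine Finset.sum_subset_zero_on_sdiff (Finset.subset_univ _) ?_ ?_
  · intro ι hι
    simp only [Finset.mem_sdiff, Finset.mem_univ, true_and, mem_assignments] at hι
    by_cases h : ∀ q, ι q ∈ H
    · rw [if_neg, Nat.cast_zero, mul_zero]
      intro h'
      exact hι ⟨h, Nat.Partition.ext h'⟩
    · push Not at h
      rw [hc0 ι (h.imp fun q hq hJ => hq (hJH hJ)), zero_mul]
  · intro ι hι
    rw [mem_assignments] at hι
    have : pattern ι = σ.parts := by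
      rw [← hι.2]
      rfl
    rw [this, if_pos rfl]

/-- Index tuples with the same pattern and entries in `H` differ by permutations of the positions
and of `H`. -/
theorem exists_perm_comp_eq {N g : ℕ} {H : Finset (Fin N)} {ι ι' : Fin g → Fin N}
    (hι : ∀ q, ι q ∈ H) (hι' : ∀ q, ι' q ∈ H) (h : pattern ι = pattern ι') :
    ∃ (τ : Equiv.Perm (Fin N)) (π : Equiv.Perm (Fin g)), (∀ i ∈ H, τ i ∈ H) ∧
      (∀ i ∉ H, τ i = i) ∧ ι' ∘ π = τ ∘ ι := by
  have hpos : ∀ ι : Fin g → Fin N, (∀ q, ι q ∈ H) → ∀ h, 0 < h →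
      (Finset.univ.filter fun i : H => fiberCard ι i = h).card = (pattern ι).count h := by
    intro ι hι h hh
    rw [count_pattern]
    refine Finset.card_bij' (fun i hi => ⟨i, ?_⟩) (fun i _ => ⟨i, ?_⟩) ?_ ?_ ?_ ?_
    · have : 0 < fiberCard ι i := by rwa [(Finset.mem_filter.1 hi).2]
      obtain ⟨q, hq⟩ := fiberCard_pos.1 this
      exact Finset.mem_image.2 ⟨q, Finset.mem_univ q, hq⟩
    · obtain ⟨q, -, hq⟩ := Finset.mem_image.1 i.2
      exact hq ▸ hι q
    all_goals simp
  -- Indices of `H` that are not attained do not show in the pattern; their number is recovered from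
  -- `|H|` and the number of parts.
  have hzero : ∀ ι : Fin g → Fin N, (∀ q, ι q ∈ H) →
      (Finset.univ.filter fun i : H => fiberCard ι i = 0).card + (pattern ι).card = H.card := by
    intro ι hι
    have h1 := Finset.card_filter_add_card_filter_not (s := (Finset.univ : Finset H))
      (fun i : H => fiberCard ι i = 0)
    rw [Finset.card_univ, Fintype.card_coe] at h1
    rw [← h1, pattern_eq, Multiset.card_map, Finset.card_val]
    congr 1
    refine Finset.card_bij (fun i hi => ⟨i, ?_⟩) ?_ ?_ ?_
    · obtain ⟨q, -, hq⟩ := Finset.mem_image.1 hi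
      exact hq ▸ hι q
    · intro i hi
      obtain ⟨q, -, hq⟩ := Finset.mem_image.1 hi
      simpa using (fiberCard_pos.2 ⟨q, hq⟩).ne'
    · intro i _ j _ hij
      exact congrArg Subtype.val hij
    · intro i hi
      obtain ⟨q, hq⟩ := fiberCard_pos.1 (Nat.pos_of_ne_zero (Finset.mem_filter.1 hi).2)
      exact ⟨i, Finset.mem_image.2 ⟨q, Finset.mem_univ q, hq⟩, rfl⟩
  obtain ⟨E, hE⟩ := exists_equiv_comp_eq (fun i : H => fiberCard ι i)
    (fun i : H => fiberCard ι' i) (by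
      intro n
      rcases Nat.eq_zero_or_pos n with rfl | hn
      · have h1 := hzero ι hι
        have h2 := hzero ι' hι'
        rw [h] at h1
        omega
      · rw [hpos ι hι n hn, hpos ι' hι' n hn, h])
  let τ : Equiv.Perm (Fin N) := Equiv.Perm.ofSubtype E
  have hτ : ∀ (i : Fin N) (hi : i ∈ H), τ i = E ⟨i, hi⟩ := fun i hi =>
    Equiv.Perm.ofSubtype_apply_of_mem E hi
  have hτ' : ∀ i ∉ H, τ i = i := fun i hi => Equiv.Perm.ofSubtype_apply_of_not_mem E hi
  obtain ⟨π, hπ⟩ := exists_equiv_comp_eq (τ ∘ ι) ι' (by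
    intro j
    change fiberCard (τ ∘ ι) j = fiberCard ι' j
    by_cases hj : j ∈ H
    · obtain ⟨i, hi⟩ := E.surjective ⟨j, hj⟩
      have hji : j = τ i := by rw [hτ i i.2, hi]
      rw [hji, fiberCard_comp ι τ.injective, hτ i i.2]
      exact (hE i).symm
    · have e1 : ¬ 0 < fiberCard (τ ∘ ι) j := by
        rw [fiberCard_pos]
        rintro ⟨q, hq⟩
        rw [Function.comp_apply, hτ _ (hι q)] at hq
        exact hj (hq ▸ (E _).2)
      have e2 : ¬ 0 < fiberCard ι' j := by
        rw [fiberCard_pos]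
        rintro ⟨q, hq⟩
        exact hj (hq ▸ hι' q)
      omega)
  refine ⟨τ, π, fun i hi => ?_, hτ', funext hπ⟩
  rw [hτ i hi]
  exact (E _).2

/-- Permuting positions is harmless by symmetry of the derivative, and a permutation moving only
indices of `H` fixes `x`. -/
theorem mixedDeriv_eq_of_mem_assignments {N g : ℕ} {H : Finset (Fin N)} {φ : (Fin N → ℝ) → ℝ}
    (hφ : IsSymmetric φ) {x : Fin N → ℝ} (hx : ∀ i ∈ H, ∀ j ∈ H, x i = x j)
    (hC : ContDiffAt ℝ (g : WithTop ℕ∞) φ x) {σ : g.Partition} {ι ι' : Fin g → Fin N}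
    (hι : ι ∈ assignments H σ) (hι' : ι' ∈ assignments H σ) :
    mixedDeriv ι φ x = mixedDeriv ι' φ x := by
  rw [mem_assignments] at hι hι'
  obtain ⟨τ, π, h1, h2, h3⟩ := exists_perm_comp_eq hι.1 hι'.1
    (congrArg Nat.Partition.parts (hι.2.trans hι'.2.symm))
  have hxτ : x ∘ τ = x := by
    ext i
    by_cases hi : i ∈ H
    · exact hx _ (h1 i hi) _ hi
    · simp [h2 i hi]
  have e1 : mixedDeriv (ι' ∘ π) φ x = mixedDeriv ι' φ x :=
    iteratedFDeriv_comp_perm hC (fun q => Pi.single (ι' q) 1) π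
  rw [← e1, h3, hφ.mixedDeriv_comp, hxτ]

/-- The limit of `D_J φ` at a point where the coordinates in `H ⊇ J` coincide. -/
theorem tendsto_DI_blockDeriv {N k : ℕ} {J H : Finset (Fin N)} (hJ : J.card = k + 1)
    (hJH : J ⊆ H) {φ : (Fin N → ℝ) → ℝ} (hφ : IsSymmetric φ) {x : Fin N → ℝ}
    (hx : ∀ i ∈ H, ∀ j ∈ H, x i = x j) (hC : ContDiffAt ℝ ((k + 1 : ℕ) : WithTop ℕ∞) φ x) :
    Filter.Tendsto (fun z => DI J φ z) (𝓝[{z | Function.Injective z}] x)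
      (𝓝 (blockDeriv H (k + 1) φ x)) := by
  obtain ⟨c, hc0, hc⟩ := exists_tendsto_DI J hJ
  have hlim := hc φ hφ x (fun i hi j hj => hx i (hJH hi) j (hJH hj)) hC
  convert hlim using 2
  have h1 : ∑ ι, c ι * mixedDeriv ι φ x =
      ∑ σ : (k + 1).Partition, ∑ ι ∈ assignments H σ, c ι * mixedDeriv ι φ x := by
    rw [← Finset.sum_subset_zero_on_sdiff
      (Finset.subset_univ (Finset.univ.filter fun ι : Fin (k + 1) → Fin N => ∀ q, ι q ∈ H))
      (fun ι hι => ?_) fun ι _ => rfl]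
    · rw [← Finset.sum_fiberwise _ patternPartition]
      refine Finset.sum_congr rfl fun σ _ => Finset.sum_congr ?_ fun _ _ => rfl
      ext ι
      simp [mem_assignments]
    · simp only [Finset.mem_sdiff, Finset.mem_univ, Finset.mem_filter, true_and,
        not_forall] at hι
      rw [hc0 ι (hι.imp fun q hq hJ => hq (hJH hJ)), zero_mul]
  rw [h1, blockDeriv]
  refine Finset.sum_congr rfl fun σ _ => ?_
  unfold partitionDeriv
  -- Without assignments both sides are empty sums, the quotient in `partitionDeriv` being `0 / 0 =
  -- 0`.
  rcases (assignments H σ).eq_empty_or_nonempty with he | hne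
  · simp [he]
  · obtain ⟨ι₀, hι₀⟩ := id hne
    have hconst : ∀ ι ∈ assignments H σ, mixedDeriv ι φ x = mixedDeriv ι₀ φ x := fun ι hι =>
      mixedDeriv_eq_of_mem_assignments hφ hx hC hι hι₀
    rw [Finset.sum_congr rfl hconst, Finset.sum_const, nsmul_eq_mul,
      mul_div_cancel_left₀ _ (by exact_mod_cast hne.card_pos.ne'),
      Finset.sum_congr rfl fun ι hι => by rw [hconst ι hι], ← Finset.sum_mul,
      sum_assignments_eq_partitionCoeff hJ hJH hc0
        (fun ψ hψ hψC => hc ψ hψ 0 (by simp) hψC) σ hne]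

/-! ### Nodes in several blocks: limits as power series coefficients. -/

/-- The power series `ΔX / (1 + ΔX)`. -/
noncomputable def geomSeries (Δ : ℝ) : PowerSeries ℝ :=
  PowerSeries.mk fun n => if n = 0 then 0 else (-1) ^ (n - 1) * Δ ^ n

/-- This functional equation is the recurrence of divided differences in generating function form.
-/
theorem geomSeries_eq (Δ : ℝ) :
    geomSeries Δ = PowerSeries.C Δ * (PowerSeries.X * (1 - geomSeries Δ)) := by
  ext n
  rw [PowerSeries.coeff_C_mul]
  cases n with
  | zero => simp [geomSeries]
  | succ n =>
    rw [PowerSeries.coeff_succ_X_mul, map_sub, PowerSeries.coeff_one]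
    cases n with
    | zero => simp [geomSeries]
    | succ n =>
      simp only [geomSeries, PowerSeries.coeff_mk, Nat.add_eq_zero_iff, one_ne_zero, and_false,
        if_false, Nat.add_sub_cancel]
      ring

theorem X_dvd_geomSeries (Δ : ℝ) : PowerSeries.X ∣ geomSeries Δ := by
  rw [geomSeries_eq]
  exact (dvd_mul_right _ _).mul_left _

/-- The functional equation yields a recurrence in `c` and `κ` which is Pascal's rule up to sign. -/
theorem coeff_geomSeries_pow (Δ : ℝ) (c : ℕ) : ∀ κ : ℕ,
    PowerSeries.coeff (c + 1) (geomSeries Δ ^ (κ + 1)) =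
      (-1) ^ (c + κ) * (c.choose κ : ℝ) * Δ ^ (c + 1) := by
  have hrec : ∀ c κ : ℕ, PowerSeries.coeff (c + 1) (geomSeries Δ ^ (κ + 1)) =
      Δ * (PowerSeries.coeff c (geomSeries Δ ^ κ) -
        PowerSeries.coeff c (geomSeries Δ ^ (κ + 1))) := by
    intro c κ
    have h : geomSeries Δ ^ (κ + 1) = PowerSeries.C Δ * (PowerSeries.X *
        (geomSeries Δ ^ κ - geomSeries Δ ^ (κ + 1))) := by
      rw [pow_succ]
      nth_rewrite 2 [geomSeries_eq]
      ring
    conv_lhs => rw [h]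
    rw [PowerSeries.coeff_C_mul, PowerSeries.coeff_succ_X_mul, map_sub]
  have h0 : ∀ κ : ℕ, PowerSeries.coeff 0 (geomSeries Δ ^ (κ + 1)) = 0 := by
    intro κ
    simp [geomSeries]
  induction c with
  | zero =>
    intro κ
    rw [hrec, h0]
    cases κ with
    | zero => simp
    | succ κ => simp [geomSeries]
  | succ c ih =>
    intro κ
    rw [hrec, ih]
    cases κ with
    | zero =>
      simp [PowerSeries.coeff_one]
      ring
    | succ κ =>
      rw [ih, Nat.choose_succ_succ]
      push_cast
      ring

theorem coeff_mul_prod_eq_zero {N : ℕ} (I : Finset (Fin N)) {B : PowerSeries ℝ}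
    (hB : PowerSeries.X ∣ B) {w : Fin N → PowerSeries ℝ} (hw : ∀ i ∈ I, PowerSeries.X ∣ w i) :
    PowerSeries.coeff I.card (B * ∏ i ∈ I, w i) = 0 := by
  have h1 : (PowerSeries.X : PowerSeries ℝ) ^ (I.card + 1) ∣ B * ∏ i ∈ I, w i := by
    rw [pow_succ', ← Finset.prod_const]
    exact mul_dvd_mul hB (Finset.prod_dvd_prod_of_dvd _ _ hw)
  exact PowerSeries.X_pow_dvd_iff.1 h1 _ (Nat.lt_succ_self _)

/-- The limit of the part of a divided difference that comes from the nodes in `H`, when all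
these nodes tend to `y`, the other ones tend to other points, and the limits of the divided
differences at nodes in `H` are known. -/
theorem tendsto_dividedDiff_ite {N d : ℕ} (H : Finset (Fin N)) (F : (Fin N → ℝ) → Fin N → ℝ)
    {x : Fin N → ℝ} {y : ℝ} (hx : ∀ i ∈ H, x i = y) (hx' : ∀ i ∉ H, x i ≠ y) (b : ℕ → ℝ)
    (hb : ∀ J ⊆ H, J.Nonempty → J.card ≤ d →
      Filter.Tendsto (fun z => dividedDiff J (F z) z) (𝓝[{z | Function.Injective z}] x)
        (𝓝 (b J.card))) {B : PowerSeries ℝ} (hXB : PowerSeries.X ∣ B)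
    (hB : ∀ n, 0 < n → PowerSeries.coeff n B = b n) {w : Fin N → PowerSeries ℝ}
    (hw : ∀ i ∈ H, w i = 1) (hw' : ∀ i ∉ H, w i = geomSeries (1 / (x i - y))) (n : ℕ)
    (hn : n ≤ d) : ∀ I : Finset (Fin N), I.card = n →
      Filter.Tendsto (fun z => dividedDiff I (fun i => if i ∈ H then F z i else 0) z)
        (𝓝[{z | Function.Injective z}] x) (𝓝 (PowerSeries.coeff n (B * ∏ i ∈ I, w i))) := by
  induction n with
  | zero =>
    intro I hI
    obtain rfl := Finset.card_eq_zero.1 hI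
    have := coeff_mul_prod_eq_zero (∅ : Finset (Fin N)) hXB (w := w) (by simp)
    rw [Finset.card_empty] at this
    rw [this]
    simp only [dividedDiff, Finset.sum_empty]
    exact tendsto_const_nhds
  | succ n ih =>
    intro I hI
    by_cases hIH : I ⊆ H
    · rw [Finset.prod_congr rfl fun i hi => hw i (hIH hi), Finset.prod_const_one, mul_one,
        hB (n + 1) n.succ_pos, ← hI]
      refine (hb I hIH (Finset.card_pos.1 (by omega)) (by omega)).congr fun z => ?_
      exact Finset.sum_congr rfl fun i hi => by simp [hIH hi]
    obtain ⟨β, hβI, hβH⟩ := Finset.not_subset.1 hIH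
    by_cases hne : ∀ a ∈ I, a ∉ H
    · rw [← hI, coeff_mul_prod_eq_zero I hXB fun i hi =>
        hw' i (hne i hi) ▸ X_dvd_geomSeries _]
      refine tendsto_const_nhds.congr fun z => ?_
      refine (Finset.sum_eq_zero fun i hi => ?_).symm
      simp [hne i hi]
    push Not at hne
    obtain ⟨a, haI, haH⟩ := hne
    -- With `a` inside `H` and `β` outside, the denominator of the recurrence tends to `x β - y`,
    -- which is nonzero.
    have hab : a ≠ β := fun h => hβH (h ▸ haH)
    obtain ⟨S, haS, hβS, rfl⟩ : ∃ S : Finset (Fin N), a ∉ S ∧ β ∉ S ∧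
        I = insert a (insert β S) := by
      refine ⟨(I.erase a).erase β, by simp, by simp, ?_⟩
      rw [Finset.insert_erase (Finset.mem_erase.2 ⟨hab.symm, hβI⟩), Finset.insert_erase haI]
    have haβS : a ∉ insert β S := by simp [hab, haS]
    have hS : S.card + 1 = n := by
      rw [Finset.card_insert_of_notMem haβS, Finset.card_insert_of_notMem hβS] at hI
      omega
    have h1 := ih (by omega) (insert a S) (by rw [Finset.card_insert_of_notMem haS, hS])
    have h2 := ih (by omega) (insert β S) (by rw [Finset.card_insert_of_notMem hβS, hS])
    have hsub : Filter.Tendsto (fun z : Fin N → ℝ => z β - z a)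
        (𝓝[{z | Function.Injective z}] x) (𝓝 (x β - y)) := by
      rw [← hx a haH]
      have : Continuous fun z : Fin N → ℝ => z β - z a := by fun_prop
      exact (this.tendsto x).mono_left nhdsWithin_le_nhds
    have hne : x β - y ≠ 0 := sub_ne_zero.2 (hx' β hβH)
    have h3 := (h1.sub h2).div hsub hne
    have hcoeff : PowerSeries.coeff (n + 1) (B * ∏ i ∈ insert a (insert β S), w i) =
        (PowerSeries.coeff n (B * ∏ i ∈ insert a S, w i) -
          PowerSeries.coeff n (B * ∏ i ∈ insert β S, w i)) / (x β - y) := by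
      rw [Finset.prod_insert haβS, Finset.prod_insert haS, Finset.prod_insert hβS, hw a haH,
        one_mul, one_mul]
      have e : B * (w β * ∏ i ∈ S, w i) = PowerSeries.C (1 / (x β - y)) *
          (PowerSeries.X * (B * ∏ i ∈ S, w i - B * (w β * ∏ i ∈ S, w i))) := by
        rw [hw' β hβH]
        conv_lhs => rw [geomSeries_eq]
        ring
      conv_lhs => rw [e]
      rw [PowerSeries.coeff_C_mul, PowerSeries.coeff_succ_X_mul, map_sub]
      ring
    rw [hcoeff]
    refine h3.congr' ?_
    filter_upwards [self_mem_nhdsWithin] with z hz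
    have hz0 : z β - z a ≠ 0 := sub_ne_zero.2 fun h => hab (hz h).symm
    rw [Pi.div_apply, div_eq_iff hz0, mul_comm, sub_mul_dividedDiff hab haS hβS _ hz]

/-! ### Summation over the index sets of size `d`. -/

open Polynomial in
/-- The polynomial in a variable counting the chosen nodes of a block of size `s`, which is the
coefficient of `(ΔX) ^ c` in `(1 + Y ΔX / (1 + ΔX)) ^ s`. -/
noncomputable def blockPoly (s c : ℕ) : ℝ[X] :=
  ∑ κ ∈ if c = 0 then {0} else Finset.Icc 1 c,
    Polynomial.C ((-1) ^ (c - κ) *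
      if 0 < c then ((c - 1).choose (κ - 1) : ℝ) * (s.choose κ : ℝ) else 1) * X ^ κ

/-- The right side is the coefficient given by the binomial theorem. Exponents `κ > c` fit too,
because `geomSeries Δ ^ κ` starts in degree `κ` or later. -/
theorem coeff_blockPoly (Δ : ℝ) (s c κ : ℕ) :
    Δ ^ c * (blockPoly s c).coeff κ =
      (s.choose κ : ℝ) * PowerSeries.coeff c (geomSeries Δ ^ κ) := by
  unfold blockPoly
  simp only [Polynomial.finsetSum_coeff, Polynomial.coeff_C_mul_X_pow]
  cases c with
  | zero =>
    cases κ with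
    | zero => simp
    | succ κ => simp [geomSeries]
  | succ c =>
    rw [if_neg (Nat.succ_ne_zero c), Finset.sum_ite_eq]
    cases κ with
    | zero => simp [PowerSeries.coeff_one]
    | succ κ =>
      rw [coeff_geomSeries_pow]
      split_ifs with h h'
      · have hκ : κ ≤ c := by
          have := (Finset.mem_Icc.1 h).2
          omega
        have hsign : (-1 : ℝ) ^ (c + 1 - (κ + 1)) = (-1) ^ (c + κ) := by
          obtain ⟨j, rfl⟩ := Nat.exists_eq_add_of_le hκ
          rw [show κ + j + 1 - (κ + 1) = j by omega, show κ + j + κ = 2 * κ + j by ring, pow_add,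
            pow_mul]
          simp
        rw [hsign, Nat.add_sub_cancel, Nat.add_sub_cancel]
        ring
      · omega
      · have hκ : c < κ := by
          by_contra h'
          exact h (Finset.mem_Icc.2 ⟨by omega, by omega⟩)
        rw [Nat.choose_eq_zero_of_lt hκ]
        simp

open Polynomial in
theorem C_X_pow_dvd_one_add_pow_sub (Δ : ℝ) (d s : ℕ) :
    (Polynomial.C (PowerSeries.X ^ d) : (PowerSeries ℝ)[X]) ∣
      (1 + Polynomial.C (geomSeries Δ) * X) ^ s -
        ∑ c ∈ Finset.range d, Polynomial.C (PowerSeries.X ^ c * PowerSeries.C (Δ ^ c)) *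
          (blockPoly s c).map PowerSeries.C := by
  rw [C_dvd_iff_dvd_coeff]
  intro κ
  rw [PowerSeries.X_pow_dvd_iff]
  intro n hn
  have h1 : ((1 + Polynomial.C (geomSeries Δ) * X) ^ s : (PowerSeries ℝ)[X]).coeff κ =
      (s.choose κ : PowerSeries ℝ) * geomSeries Δ ^ κ := by
    have : (1 + Polynomial.C (geomSeries Δ) * X : (PowerSeries ℝ)[X]) ^ s =
        ((1 + X) ^ s : (PowerSeries ℝ)[X]).comp (Polynomial.C (geomSeries Δ) * X) := by simp
    rw [this, comp_C_mul_X_coeff, coeff_one_add_X_pow]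
  rw [coeff_sub, h1, finsetSum_coeff, map_sub, map_sum]
  simp only [coeff_C_mul, coeff_map]
  rw [Finset.sum_eq_single_of_mem n (Finset.mem_range.2 hn)]
  · rw [mul_assoc, ← map_mul, coeff_blockPoly, PowerSeries.coeff_X_pow_mul']
    have : (s.choose κ : PowerSeries ℝ) = PowerSeries.C (s.choose κ : ℝ) := by simp
    rw [this, PowerSeries.coeff_C_mul]
    simp
  · intro c _ hcn
    rw [mul_assoc, ← map_mul, PowerSeries.coeff_X_pow_mul']
    split_ifs with h
    · rw [PowerSeries.coeff_C, if_neg (by omega)]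
    · rfl

theorem dvd_prod_sub_prod {R T : Type*} [CommRing R] (s : Finset T) {p : R} {f g : T → R}
    (h : ∀ t ∈ s, p ∣ f t - g t) : p ∣ ∏ t ∈ s, f t - ∏ t ∈ s, g t := by
  rw [← Ideal.mem_span_singleton, ← Ideal.Quotient.mk_eq_mk_iff_sub_mem, map_prod, map_prod]
  refine Finset.prod_congr rfl fun t ht => ?_
  rw [Ideal.Quotient.mk_eq_mk_iff_sub_mem, Ideal.mem_span_singleton]
  exact h t ht

open Polynomial in
theorem coeff_one_add_X_pow_mul_prod_blockPoly {M : ℕ} (s : Fin M → ℕ) (d : ℕ) (α : Fin M)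
    {c : {β : Fin M // β ≠ α} → ℕ} (hc : ∑ β, c β < d) :
    ((1 + X) ^ s α * ∏ β : {β : Fin M // β ≠ α}, blockPoly (s β) (c β) : ℝ[X]).coeff d =
      (SymmDeriv.C s d α c : ℝ) := by
  unfold blockPoly SymmDeriv.C Xi
  rw [Finset.prod_univ_sum, Finset.mul_sum, finsetSum_coeff]
  push_cast
  refine Finset.sum_congr rfl fun κ hκ => ?_
  -- Hence `∑ κ β < d`, so the lower index `d - ∑ κ β` is not truncated.
  have hκc : ∑ β, κ β ≤ ∑ β, c β := by
    refine Finset.sum_le_sum fun β _ => ?_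
    have := Fintype.mem_piFinset.1 hκ β
    split_ifs at this with h
    · simp at this
      omega
    · exact (Finset.mem_Icc.1 this).2
  rw [Finset.prod_mul_distrib, Finset.prod_pow_eq_pow_sum, ← map_prod, ← mul_assoc,
    coeff_mul_X_pow', if_pos (by omega), mul_comm, coeff_C_mul, coeff_one_add_X_pow,
    Finset.prod_mul_distrib, Finset.prod_pow_eq_pow_sum, Finset.prod_filter]
  ring

open Polynomial in
-- The sum over `I` is the coefficient of `Y ^ d` in `∏ (1 + w i Y)`, a product of one power per
-- block. Since `X ∣ B`, each block factor matters only modulo `X ^ d`, where it is a combination of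
-- the `blockPoly`.
theorem sum_powersetCard_coeff {N M d : ℕ} (blk : Fin N → Fin M) (y : Fin M → ℝ) (α : Fin M)
    (B : PowerSeries ℝ) (hB : PowerSeries.X ∣ B) :
    ∑ I ∈ (Finset.univ : Finset (Fin N)).powersetCard d, PowerSeries.coeff d (B * ∏ i ∈ I,
      if blk i = α then 1 else geomSeries (1 / (y (blk i) - y α))) =
    ∑ c ∈ exponents d α, (SymmDeriv.C (fiberCard blk) d α c : ℝ) *
      (PowerSeries.coeff (d - ∑ β, c β) B / ∏ β : {β : Fin M // β ≠ α}, (y β - y α) ^ c β) := by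
  set w : Fin M → PowerSeries ℝ := fun β => if β = α then 1 else geomSeries (1 / (y β - y α))
  set P : {β : Fin M // β ≠ α} → (PowerSeries ℝ)[X] := fun β =>
    ∑ c ∈ Finset.range d,
      Polynomial.C (PowerSeries.X ^ c * PowerSeries.C ((1 / (y β - y α)) ^ c)) *
        (blockPoly (fiberCard blk β) c).map PowerSeries.C with hP
  have h1 : ∑ I ∈ (Finset.univ : Finset (Fin N)).powersetCard d, ∏ i ∈ I, w (blk i) =
      (∏ i, (1 + Polynomial.C (w (blk i)) * X) : (PowerSeries ℝ)[X]).coeff d := by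
    rw [Finset.prod_one_add, finsetSum_coeff, Finset.powersetCard_eq_filter,
      Finset.sum_filter]
    refine Finset.sum_congr rfl fun I _ => ?_
    rw [Finset.prod_mul_distrib, Finset.prod_const, ← map_prod, coeff_C_mul_X_pow]
    simp_rw [eq_comm]
  have h2 : (∏ i, (1 + Polynomial.C (w (blk i)) * X) : (PowerSeries ℝ)[X]) =
      (1 + X) ^ fiberCard blk α * ∏ β : {β : Fin M // β ≠ α},
        (1 + Polynomial.C (geomSeries (1 / (y β - y α))) * X) ^ fiberCard blk β := by
    have hfib : (∏ i, (1 + Polynomial.C (w (blk i)) * X) : (PowerSeries ℝ)[X]) =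
        ∏ β, (1 + Polynomial.C (w β) * X) ^ fiberCard blk β := by
      rw [← Finset.prod_fiberwise Finset.univ blk]
      refine Finset.prod_congr rfl fun β _ => ?_
      rw [Finset.prod_congr rfl (g := fun _ => 1 + Polynomial.C (w β) * X)
        (fun i hi => by rw [(Finset.mem_filter.1 hi).2]), Finset.prod_const]
      rfl
    rw [hfib, ← Finset.mul_prod_erase _ _ (Finset.mem_univ α)]
    congr 1
    · simp [w]
    · rw [Finset.prod_subtype (Finset.univ.erase α) (p := fun β => β ≠ α) (by simp)]
      exact Finset.prod_congr rfl fun β _ => by simp [w, β.2]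
  have h3 : (Polynomial.C (PowerSeries.X ^ d) : (PowerSeries ℝ)[X]) ∣
      (∏ i, (1 + Polynomial.C (w (blk i)) * X)) - (1 + X) ^ fiberCard blk α * ∏ β, P β := by
    rw [h2, ← mul_sub]
    exact (dvd_prod_sub_prod _ fun β _ => C_X_pow_dvd_one_add_pow_sub _ _ _).mul_left _
  have h4 : PowerSeries.coeff d (B * (∏ i, (1 + Polynomial.C (w (blk i)) * X) :
      (PowerSeries ℝ)[X]).coeff d) =
      PowerSeries.coeff d (B * ((1 + X) ^ fiberCard blk α * ∏ β, P β).coeff d) := by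
    rw [← sub_eq_zero, ← map_sub, ← mul_sub, ← coeff_sub]
    refine PowerSeries.X_pow_dvd_iff.1 ?_ d (Nat.lt_succ_self d)
    rw [pow_succ']
    exact mul_dvd_mul hB (C_dvd_iff_dvd_coeff _ _ |>.1 h3 d)
  rw [← map_sum, ← Finset.mul_sum, h1, h4, hP, Finset.prod_univ_sum, Finset.mul_sum,
    finsetSum_coeff, Finset.mul_sum, map_sum, exponents, Finset.sum_filter]
  refine Finset.sum_congr rfl fun c _ => ?_
  have h5 : ((1 + X) ^ fiberCard blk α * ∏ β : {β : Fin M // β ≠ α},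
      (Polynomial.C (PowerSeries.X ^ c β * PowerSeries.C ((1 / (y β - y α)) ^ c β)) *
        (blockPoly (fiberCard blk β) (c β)).map PowerSeries.C) : (PowerSeries ℝ)[X]) =
      Polynomial.C (PowerSeries.X ^ (∑ β, c β) *
        PowerSeries.C (∏ β : {β : Fin M // β ≠ α}, (1 / (y β - y α)) ^ c β)) *
      ((1 + X) ^ fiberCard blk α * ∏ β : {β : Fin M // β ≠ α},
        blockPoly (fiberCard blk β) (c β)).map PowerSeries.C := by
    rw [Finset.prod_mul_distrib, ← map_prod, Finset.prod_mul_distrib, ← map_prod,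
      Finset.prod_pow_eq_pow_sum, Polynomial.map_mul, Polynomial.map_prod, Polynomial.map_pow,
      Polynomial.map_add, Polynomial.map_one, Polynomial.map_X]
    ring
  rw [h5, coeff_C_mul, coeff_map]
  have h6 : ∀ a r : ℝ, B * (PowerSeries.X ^ (∑ β, c β) * PowerSeries.C a * PowerSeries.C r) =
      PowerSeries.C (a * r) * (B * PowerSeries.X ^ (∑ β, c β)) := by
    intro a r
    rw [map_mul]
    ring
  rw [h6, PowerSeries.coeff_C_mul, PowerSeries.coeff_mul_X_pow']
  split_ifs with h h' h'
  · rw [coeff_one_add_X_pow_mul_prod_blockPoly _ _ _ h']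
    simp only [one_div, inv_pow, Finset.prod_inv_distrib]
    ring
  -- The boundary tuples meet only the constant term of `B`, which is zero; this is why the formula
  -- has the strict inequality.
  · obtain rfl : d = ∑ β, c β := by omega
    rw [Nat.sub_self, PowerSeries.coeff_zero_eq_constantCoeff,
      PowerSeries.X_dvd_iff.1 hB, mul_zero]
  · omega
  · rw [mul_zero]

end SymmDeriv

/-! ### Assembly of the block contributions. -/

theorem proposition3p8 {N M : ℕ} (φ : (Fin N → ℝ) → ℝ) (hsymm : SymmDeriv.IsSymmetric φ)
    (d : ℕ) (hd : 1 ≤ d) (hdN : d ≤ N)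
    (H : Fin M → Finset (Fin N)) (hne : ∀ α, (H α).Nonempty)
    (hdisj : ∀ α β, α ≠ β → Disjoint (H α) (H β)) (hcover : ∀ i, ∃ α, i ∈ H α)
    (y : Fin M → ℝ) (hy : ∀ α β, α ≠ β → y α ≠ y β)
    (x : Fin N → ℝ) (hx : ∀ α, ∀ i ∈ H α, x i = y α)
    (hφ : ∀ α, ContDiffAt ℝ ((min d (H α).card : ℕ) : WithTop ℕ∞) φ x) :
    Filter.Tendsto (fun z => SymmDeriv.D d φ z) (𝓝[{z | Function.Injective z}] x)
      (𝓝 ((d.factorial : ℝ) * ∑ α : Fin M, ∑ c ∈ SymmDeriv.exponents d α,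
        (SymmDeriv.C (fun β => (H β).card) d α c : ℝ) *
          (SymmDeriv.blockDeriv (H α) (d - ∑ β, c β) φ x / ∏ β : {β : Fin M // β ≠ α}, (y β - y α) ^ (c β)))) := by
  choose blk hblk using hcover
  have hmem : ∀ i α, i ∈ H α ↔ blk i = α := by
    intro i α
    refine ⟨fun hi => ?_, fun h => h ▸ hblk i⟩
    by_contra hne
    exact Finset.disjoint_left.1 (hdisj _ _ hne) (hblk i) hi
  have hcard : (fun β => (H β).card) = SymmDeriv.fiberCard blk := by
    ext β
    exact congrArg Finset.card (by ext i; simp [hmem])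
  have hxblk : ∀ i, x i = y (blk i) := fun i => hx _ i (hblk i)
  set b : Fin M → ℕ → ℝ := fun α n => SymmDeriv.blockDeriv (H α) n φ x
  -- The constant term is set to `0` because an index set without nodes in block `α` contributes
  -- nothing.
  set B : Fin M → PowerSeries ℝ := fun α => PowerSeries.mk fun n => if n = 0 then 0 else b α n
  have hXB : ∀ α, PowerSeries.X ∣ B α := fun α => PowerSeries.X_dvd_iff.2 (by simp [B])
  have hBcoeff : ∀ α n, 0 < n → PowerSeries.coeff n (B α) = b α n := fun α n hn => by
    simp [B, hn.ne']
  have hsplit : ∀ z, SymmDeriv.D d φ z = (d.factorial : ℝ) * ∑ α : Fin M,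
      ∑ I ∈ (Finset.univ : Finset (Fin N)).powersetCard d,
        SymmDeriv.dividedDiff I
          (fun i => if i ∈ H α then SymmDeriv.partialDeriv i φ z else 0) z := by
    intro z
    rw [SymmDeriv.D, Finset.sum_comm]
    congr 1
    refine Finset.sum_congr rfl fun I _ => ?_
    rw [← SymmDeriv.dividedDiff_sum, SymmDeriv.DI_eq_dividedDiff]
    simp [hmem]
  have hlim : ∀ α, ∀ I ∈ (Finset.univ : Finset (Fin N)).powersetCard d,
      Filter.Tendsto (fun z => SymmDeriv.dividedDiff I
          (fun i => if i ∈ H α then SymmDeriv.partialDeriv i φ z else 0) z)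
        (𝓝[{z | Function.Injective z}] x)
        (𝓝 (PowerSeries.coeff d (B α * ∏ i ∈ I,
          if blk i = α then 1 else SymmDeriv.geomSeries (1 / (y (blk i) - y α))))) := by
    intro α I hI
    refine SymmDeriv.tendsto_dividedDiff_ite (H α) (fun z i => SymmDeriv.partialDeriv i φ z)
      (hx α) (fun i hi => ?_) (b α) (fun J hJ hJne hJd => ?_) (hXB α) (hBcoeff α)
      (fun i hi => if_pos ((hmem i α).1 hi)) (fun i hi => ?_) d le_rfl I
      (Finset.mem_powersetCard.1 hI).2
    · rw [hxblk]
      exact hy _ _ fun h => hi ((hmem i α).2 h)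
    · obtain ⟨k, hk⟩ := Nat.exists_eq_succ_of_ne_zero hJne.card_pos.ne'
      rw [hk]
      refine SymmDeriv.tendsto_DI_blockDeriv hk hJ hsymm
        (fun i hi j hj => (hx α i hi).trans (hx α j hj).symm) ((hφ α).of_le ?_)
      -- Only subsets `J` of one block with at most `d` elements occur, so class `C^min(d, |H α|)`
      -- suffices.
      exact_mod_cast hk ▸ le_min hJd (Finset.card_le_card hJ)
    · rw [if_neg fun h => hi ((hmem i α).2 h), hxblk]
  simp_rw [hsplit]
  refine Filter.Tendsto.const_mul _ (tendsto_finsetSum _ fun α _ => ?_)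
  have h := tendsto_finsetSum _ (hlim α)
  rw [SymmDeriv.sum_powersetCard_coeff blk y α (B α) (hXB α), ← hcard] at h
  convert h using 2
  refine Finset.sum_congr rfl fun c hc => ?_
  rw [hBcoeff α _ (Nat.sub_pos_of_lt (Finset.mem_filter.1 hc).2)]
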